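/- For a Gaussian prime $\pi$ of odd norm $N(\pi)$ and $\alpha\in\mathbb Z[i]$ let $\left(\frac{\alpha}{\pi}\right)_4$ be $0$ if $\pi\mid\alpha$, and otherwise the unique element of $\{1,i,-1,-i\}$ congruent to $\alpha^{(N(\pi)-1)/4}$ modulo $\pi$. For $\beta\in\mathbb Z[i]$ of odd norm, the quartic Jacobi symbol $\left(\frac{\alpha}{\beta}\right)_4$ is the product of the symbols $\left(\frac{\alpha}{\pi}\right)_4$ over the prime factors $\pi$ of $\beta$, counted with multiplicity. For an odd integer $m$ and a rational number $r$ whose denominator is prime to $m$, put $\left(\frac{r+i}{m}\right)_4=\left(\frac{n+i}{m}\right)_4$, where $n$ is any integer with $n\equiv r\pmod m$. **Theorem 3.2.** Let $p\equiv 1\pmod 4$ be a prime and let $q\in\mathbb Z$ satisfy $q\equiv 3\pmod 8$ and $p\nmid q$. Suppose that $p=c^2+d^2$ and $4p=x^2+qy^2$ with $c,d,x,y\in\mathbb Z$, $c\equiv y\equiv 1\pmod 4$ and $\gcd(d,x+2c)=1$, and let $k\in\mathbb Z$ satisfy $$\left(\frac{-2d/(x+2c)+i}{q}\right)_4=i^k.$$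 (Under these assumptions $x$ is odd, $p\nmid cx$, and $x+2c$ is nonzero and prime to $q$.) Then $$(-q)^{[p/8]}\equiv\begin{cases}(-1)^{[x/4]}\left(\dfrac dc\right)^k\pmod p&\text{if }8\mid p-1,\\[2mm]-(-1)^{(x^2-1)/8}\left(\dfrac dc\right)^k\dfrac yx\pmod p&\text{if }8\mid p-5,\end{cases}$$ where $[\cdot]$ is the greatest integer function and fractions are read modulo $p$. -/

import Mathlib

/-- The quartic residue symbol `(α/π)₄` for a Gaussian prime `π` of odd norm `N(π)`: it is `0` if
`π ∣ α`, and otherwise the unique `u ∈ {1, i, -1, -i}` with `α ^ ((N(π) - 1) / 4) ≡ u (mod π)`.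
(When `π ∤ α` has odd norm, one of the first three congruences below holds or else `u = -i`.) -/
noncomputable def quarticResidueSymbol (α π : GaussianInt) : GaussianInt :=
  open Classical in
  if π ∣ α then 0
  else if π ∣ α ^ (((Zsqrtd.norm π).natAbs - 1) / 4) - 1 then 1
  else if π ∣ α ^ (((Zsqrtd.norm π).natAbs - 1) / 4) - ⟨0, 1⟩ then ⟨0, 1⟩
  else if π ∣ α ^ (((Zsqrtd.norm π).natAbs - 1) / 4) + 1 then -1
  else -⟨0, 1⟩

/-- The quartic Jacobi symbol `(α/β)₄` for a Gaussian integer `β` of odd norm: the product of the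
symbols `(α/π)₄` over the prime factors `π` of `β`, with multiplicity; it is `1` if `β` is a unit.
The choice of the prime factors up to units does not matter. -/
noncomputable def quarticJacobiSymbol (α β : GaussianInt) : GaussianInt :=
  ((UniqueFactorizationMonoid.factors β).map (quarticResidueSymbol α)).prod

/-- An integer congruent to the rational number `r` modulo `m`, whenever the denominator of `r` is
prime to `m`: the numerator times a Bézout inverse of the denominator. -/
def ratResidue (r : ℚ) (m : ℤ) : ℤ :=
  r.num * Int.gcdA r.den m

theorem ratResidue_spec (r : ℚ) (m : ℤ) (h : Int.gcd r.den m = 1) :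
    r.den * ratResidue r m ≡ r.num [ZMOD m] := by
  have h1 := Int.gcd_eq_gcd_ab r.den m
  rw [h] at h1
  refine (Int.modEq_iff_dvd.2 ⟨r.num * Int.gcdB r.den m, ?_⟩)
  unfold ratResidue
  push_cast at h1
  linear_combination r.num * h1

/-- The quartic Jacobi symbol `((r + i)/m)₄` for an odd integer `m` and a rational number `r` with
denominator prime to `m`; here `r` is read modulo `m`. -/
noncomputable def quarticJacobiSymbolRat (r : ℚ) (m : ℤ) : GaussianInt :=
  quarticJacobiSymbol ⟨ratResidue r m, 1⟩ ⟨m, 0⟩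

/-!
Put `π = c + di`. Reduction modulo `π` sends `i` to `d / c` and the symbol of an integer `n` over
`π` to `n ^ ((p - 1) / 4)`. As `-q ≡ (x / y) ^ 2` modulo `p`, one has to evaluate the symbols of
`x` and `y` over `π`; by quartic reciprocity between integers and Gaussian integers, these are,
up to signs, the symbols of `π` over `x` and `y`. The element `γ = x + 2π` links them to `q`: its
square is `4 (x + 2c) π` modulo `y`, while `q y ^ 2 ≡ -2x (x + 2c)` modulo `γ`, and `γ ≡ 2π`
modulo `x`. Since `4 ∣ im γ`, reciprocity for `γ` turns these congruences into a relation between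
the symbols of `γ` over `q` and of `π` over `x` and `y`.

Reciprocity for a prime `π` of prime norm rests on the quartic character modulo `π`, whose Jacobi
sum is `±π` if `im π` is even: the fourth power of its Gauss sum is then `π ^ 3 * star π`, and
raising the Gauss sum to the `r`-th power in characteristic `r` gives the symbol of `r` over `π`.
-/

namespace QuarticReciprocity

open GaussianInt UniqueFactorizationMonoid

local notation "ℤ[i]" => GaussianInt
local notation "𝐢" => (Zsqrtd.sqrtd : GaussianInt)

section GaussianIntegers

theorem sqrtd_sq : 𝐢 ^ 2 = -1 := by decide

theorem sqrtd_pow_four : 𝐢 ^ 4 = 1 := by decide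

theorem norm_eq_sq_add_sq (α : ℤ[i]) : α.norm = α.re ^ 2 + α.im ^ 2 := by
  rw [Zsqrtd.norm_def]; ring

theorem odd_norm_mul {α β : ℤ[i]} (hα : Odd α.norm) (hβ : Odd β.norm) : Odd (α * β).norm := by
  rw [Zsqrtd.norm_mul]; exact hα.mul hβ

theorem odd_norm_star {α : ℤ[i]} (hα : Odd α.norm) : Odd (star α).norm := by
  rwa [Zsqrtd.norm_conj]

theorem odd_norm_intCast {n : ℤ} : Odd (n : ℤ[i]).norm ↔ Odd n := by
  rw [Zsqrtd.norm_intCast, Int.odd_mul, and_self]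

theorem ne_zero_of_odd_norm {α : ℤ[i]} (hα : Odd α.norm) : α ≠ 0 := by
  rintro rfl; simp at hα

theorem odd_norm_iff_odd_re {α : ℤ[i]} (him : Even α.im) : Odd α.norm ↔ Odd α.re := by
  rw [norm_eq_sq_add_sq, Int.odd_add, Int.odd_pow' two_ne_zero, Int.even_pow' two_ne_zero,
    iff_true_right him]

theorem even_im_of_odd_norm {α : ℤ[i]} (hα : Odd α.norm) (hre : Odd α.re) : Even α.im := by
  rw [norm_eq_sq_add_sq] at hα
  exact (Int.even_pow' two_ne_zero).1 ((Int.odd_add.1 hα).1 hre.pow)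

theorem norm_emod_four {α : ℤ[i]} (hα : Odd α.norm) : α.norm % 4 = 1 := by
  have mod_four (n : ℤ) : n ^ 2 % 4 = 0 ∨ n ^ 2 % 4 = 1 := by
    rcases Int.even_or_odd n with hn | hn
    · exact Or.inl (Int.emod_eq_zero_of_dvd (by simpa using pow_dvd_pow_of_dvd hn.two_dvd 2))
    · exact Or.inr (Int.sq_mod_four_eq_one_of_odd hn)
  rw [norm_eq_sq_add_sq] at hα ⊢
  rw [Int.odd_iff] at hα
  rcases mod_four α.re with h | h <;> rcases mod_four α.im with h' | h' <;> omega

theorem star_intCast (n : ℤ) : star (n : ℤ[i]) = n := by ext <;> simp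

theorem isCoprime_intCast {m n : ℤ} (h : IsCoprime m n) : IsCoprime (m : ℤ[i]) (n : ℤ[i]) :=
  h.map (Int.castRingHom ℤ[i])

theorem prime_star {π : ℤ[i]} (hπ : Prime π) : Prime (star π) :=
  (MulEquiv.prime_iff (starMulAut : MulAut ℤ[i])).2 hπ

theorem sq_eq_one_of_norm_eq_one {u : ℤ[i]} (h : u.norm = 1) (hre : u.re ≠ 0) : u ^ 2 = 1 := by
  rw [norm_eq_sq_add_sq] at h
  have him : u.im ^ 2 = 0 := by linarith [sq_pos_of_ne_zero hre, sq_nonneg u.im]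
  rw [pow_eq_zero_iff two_ne_zero] at him
  rw [him, zero_pow two_ne_zero, add_zero] at h
  have hu : u = (u.re : ℤ) := Zsqrtd.ext rfl him
  rw [hu, ← Int.cast_pow, h, Int.cast_one]

theorem eq_zero_or_of_pow_five_eq {u : ℤ[i]} (h : u ^ 5 = u) :
    u = 0 ∨ u = 1 ∨ u = -1 ∨ u = 𝐢 ∨ u = -𝐢 := by
  have hfactor : u * ((u - 1) * ((u + 1) * ((u - 𝐢) * (u + 𝐢)))) = 0 := by
    linear_combination h + (u - u ^ 3) * sqrtd_sq
  simpa only [mul_eq_zero, sub_eq_zero, add_eq_zero_iff_eq_neg] using hfactor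

theorem mul_star_of_pow_four {u : ℤ[i]} (h : u ^ 4 = 1) : u * star u = 1 := by
  rw [← Zsqrtd.norm_eq_mul_conj, (Zsqrtd.norm_eq_one_iff' (by norm_num) u).2
    (IsUnit.of_pow_eq_one h four_ne_zero), Int.cast_one]

/-- The differences between elements of `{0, ±1, ±i}` have norm dividing `4`, so they are
not divisible by a non-unit of odd norm. -/
theorem eq_of_dvd_sub {π u v : ℤ[i]} (hπ : ¬ IsUnit π) (hodd : Odd π.norm)
    (hu : u ^ 5 = u) (hv : v ^ 5 = v) (h : π ∣ u - v) : u = v := by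
  by_contra hne
  have hnorm : (u - v).norm ∣ 4 := by
    rcases eq_zero_or_of_pow_five_eq hu with rfl | rfl | rfl | rfl | rfl <;>
      rcases eq_zero_or_of_pow_five_eq hv with rfl | rfl | rfl | rfl | rfl <;>
      first | exact absurd rfl hne | decide
  have hdvd : π.norm ∣ 2 ^ 2 := (map_dvd Zsqrtd.normMonoidHom h).trans hnorm
  have hcop : IsCoprime π.norm (2 ^ 2) := (Int.isCoprime_two_right.2 hodd).pow_right
  exact hπ ((Zsqrtd.isUnit_iff_norm_isUnit π).2 (hcop.isUnit_of_dvd' dvd_rfl hdvd))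

theorem prime_of_norm_eq {p : ℕ} (hp : p.Prime) {π : ℤ[i]} (hn : π.norm = p) : Prime π := by
  refine Irreducible.prime ⟨fun hu => hp.one_lt.ne' ?_, fun α β hαβ => ?_⟩
  · rw [← Zsqrtd.norm_eq_one_iff.2 hu, hn, Int.natAbs_natCast]
  · have hmul : α.norm.natAbs * β.norm.natAbs = p := by
      rw [← Int.natAbs_mul, ← Zsqrtd.norm_mul, ← hαβ, hn, Int.natAbs_natCast]
    rw [← Zsqrtd.norm_eq_one_iff, ← Zsqrtd.norm_eq_one_iff]
    exact (Nat.prime_mul_iff.1 (hmul ▸ hp)).symm.imp And.right And.right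

theorem exists_norm_eq {p : ℕ} [Fact p.Prime] (hp : p % 4 = 1) : ∃ π : ℤ[i], π.norm = p := by
  obtain ⟨a, b, hab⟩ := Nat.Prime.sq_add_sq (p := p) (by omega)
  exact ⟨⟨a, b⟩, by rw [norm_eq_sq_add_sq, ← hab]; push_cast; rfl⟩

theorem exists_natPrime_dvd {π : ℤ[i]} (hπ : Prime π) : ∃ p : ℕ, p.Prime ∧ π ∣ p := by
  have hdvd : π ∣ (π.norm.natAbs : ℤ[i]) := by
    rw [natCast_natAbs_norm, Zsqrtd.norm_eq_mul_conj]
    exact dvd_mul_right _ _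
  have hne : π.norm.natAbs ≠ 0 := by
    rw [Int.natAbs_ne_zero, Ne, norm_eq_zero]; exact hπ.ne_zero
  rw [← Nat.prod_primeFactorsList hne, Nat.cast_list_prod, hπ.dvd_prod_iff] at hdvd
  obtain ⟨_, hmem, hdvd⟩ := hdvd
  obtain ⟨p, hp, rfl⟩ := List.mem_map.1 hmem
  exact ⟨p, Nat.prime_of_mem_primeFactorsList hp, hdvd⟩

theorem split_or_inert {π : ℤ[i]} (hπ : Prime π) (hodd : Odd π.norm) :
    ∃ p : ℕ, p.Prime ∧ π ∣ p ∧ (p % 4 = 1 ∧ π.norm = p ∨ p % 4 = 3 ∧ Associated π p) := by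
  obtain ⟨p, hp, hdvd⟩ := exists_natPrime_dvd hπ
  have := Fact.mk hp
  have hdvd_sq : π.norm.natAbs ∣ p ^ 2 := by
    have := Int.natAbs_dvd_natAbs.2 (map_dvd Zsqrtd.normMonoidHom hdvd)
    simpa [Zsqrtd.normMonoidHom, Zsqrtd.norm_natCast, Int.natAbs_mul, sq] using this
  have hmod := norm_emod_four hodd
  have habs := abs_natCast_norm π
  refine ⟨p, hp, hdvd, ?_⟩
  obtain ⟨k, hk, hnorm⟩ := (Nat.dvd_prime_pow hp).1 hdvd_sq
  interval_cases k
  · exact absurd (Zsqrtd.norm_eq_one_iff.1 (by simpa using hnorm)) hπ.not_isUnit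
  · rw [pow_one] at hnorm
    exact Or.inl ⟨by omega, by omega⟩
  · obtain ⟨γ, hγ⟩ := hdvd
    have hγ_norm : p ^ 2 * γ.norm.natAbs = p ^ 2 * 1 := by
      rw [← hnorm, ← Int.natAbs_mul, ← Zsqrtd.norm_mul, ← hγ, Zsqrtd.norm_natCast, hnorm,
        Int.natAbs_mul, Int.natAbs_natCast, mul_one, sq]
    have hγ_unit := Zsqrtd.norm_eq_one_iff.1 (Nat.eq_of_mul_eq_mul_left (pow_pos hp.pos 2) hγ_norm)
    have hassoc : Associated π p := hγ ▸ (associated_mul_isUnit_right_iff hγ_unit).2 (.refl π)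
    exact Or.inr ⟨mod_four_eq_three_of_nat_prime_of_prime p (hassoc.prime hπ), hassoc⟩

end GaussianIntegers

section ResidueField

variable {π : ℤ[i]} {r : ℕ} {K : Type*}

theorem exists_ringHom_isAlgClosed (hπ : Prime π) (hr : r.Prime) (hdvd : π ∣ r) :
    ∃ (K : Type) (_ : Field K) (_ : IsAlgClosed K) (_ : CharP K r) (φ : ℤ[i] →+* K),
      ∀ α, φ α = 0 ↔ π ∣ α := by
  have : (Ideal.span {π}).IsPrime := (Ideal.span_singleton_prime hπ.ne_zero).2 hπ
  let F := FractionRing (ℤ[i] ⧸ Ideal.span {π})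
  let φ : ℤ[i] →+* AlgebraicClosure F :=
    (algebraMap F _).comp ((algebraMap (ℤ[i] ⧸ Ideal.span {π}) F).comp (Ideal.Quotient.mk _))
  have hφ (α : ℤ[i]) : φ α = 0 ↔ π ∣ α := by
    rw [RingHom.comp_apply, map_eq_zero, RingHom.comp_apply, FaithfulSMul.algebraMap_eq_zero_iff,
      Ideal.Quotient.eq_zero_iff_mem, Ideal.mem_span_singleton]
  exact ⟨_, inferInstance, inferInstance,
    (CharP.charP_iff_prime_eq_zero hr).2 (by simpa using (hφ r).2 hdvd), φ, hφ⟩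

theorem map_pow_char [CommRing K] [Fact r.Prime] [CharP K r] (φ : ℤ[i] →+* K) (α : ℤ[i]) :
    φ α ^ r = φ (α.re + α.im * 𝐢 ^ r) := by
  have hα : α = α.re + α.im * 𝐢 := by ext <;> simp
  have hfix (n : ℤ) : (n : K) ^ r = n := map_intCast (frobenius K r) n
  conv_lhs => rw [hα]
  simp only [map_add, map_mul, map_pow, map_intCast, add_pow_char, mul_pow, hfix]

theorem map_pow_char_of_mod_four_eq_one [CommRing K] [Fact r.Prime] [CharP K r] (hr : r % 4 = 1)
    (φ : ℤ[i] →+* K) (α : ℤ[i]) : φ α ^ r = φ α := by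
  rw [map_pow_char, pow_eq_pow_mod r sqrtd_pow_four, hr]
  congr 1
  ext <;> simp

theorem map_pow_char_of_mod_four_eq_three [CommRing K] [Fact r.Prime] [CharP K r] (hr : r % 4 = 3)
    (φ : ℤ[i] →+* K) (α : ℤ[i]) : φ α ^ r = φ (star α) := by
  rw [map_pow_char, pow_eq_pow_mod r sqrtd_pow_four, hr, pow_succ, sqrtd_sq]
  congr 1
  ext <;> simp

theorem dvd_pow_norm_sub (hπ : Prime π) (hodd : Odd π.norm) (α : ℤ[i]) :
    π ∣ α ^ π.norm.natAbs - α := by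
  obtain ⟨p, hp, hdvd, hcases⟩ := split_or_inert hπ hodd
  have := Fact.mk hp
  obtain ⟨K, _, _, _, φ, hφ⟩ := exists_ringHom_isAlgClosed hπ hp hdvd
  rw [← hφ, map_sub, map_pow, sub_eq_zero]
  rcases hcases with ⟨h4, hn⟩ | ⟨h4, hassoc⟩
  · rw [hn, Int.natAbs_natCast, map_pow_char_of_mod_four_eq_one h4]
  · rw [Zsqrtd.norm_eq_of_associated (by norm_num) hassoc, Zsqrtd.norm_natCast, Int.natAbs_mul,
      Int.natAbs_natCast, pow_mul, map_pow_char_of_mod_four_eq_three h4,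
      map_pow_char_of_mod_four_eq_three h4, star_star]

theorem eq_of_map_eq [Ring K] (hπ : Prime π) (hodd : Odd π.norm) {φ : ℤ[i] →+* K}
    (hφ : ∀ α, φ α = 0 ↔ π ∣ α) {u v : ℤ[i]} (hu : u ^ 5 = u) (hv : v ^ 5 = v)
    (h : φ u = φ v) : u = v :=
  eq_of_dvd_sub hπ.not_isUnit hodd hu hv ((hφ _).1 (by rw [map_sub, h, sub_self]))

end ResidueField

section ResidueSymbol

/-- The exponent `(N(α) - 1) / 4` of Euler's criterion for quartic residues. -/
abbrev quarticExp (α : ℤ[i]) : ℕ := (α.norm.natAbs - 1) / 4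

variable {α β π : ℤ[i]}

theorem four_mul_quarticExp_add_one (hα : Odd α.norm) : 4 * quarticExp α + 1 = α.norm.natAbs := by
  have := norm_emod_four hα
  have := abs_natCast_norm α
  unfold quarticExp
  omega

theorem four_mul_quarticExp_add_one_int (hα : Odd α.norm) :
    4 * (quarticExp α : ℤ) + 1 = α.norm := by
  rw [← abs_natCast_norm, ← four_mul_quarticExp_add_one hα]; push_cast; rfl

theorem quarticExp_mul (hα : Odd α.norm) (hβ : Odd β.norm) :
    quarticExp (α * β) = quarticExp α + quarticExp β + 4 * (quarticExp α * quarticExp β) := by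
  have h := four_mul_quarticExp_add_one (odd_norm_mul hα hβ)
  rw [Zsqrtd.norm_mul, Int.natAbs_mul, ← four_mul_quarticExp_add_one hα,
    ← four_mul_quarticExp_add_one hβ] at h
  linarith

theorem quarticExp_of_isUnit (hα : IsUnit α) : quarticExp α = 0 := by
  simp [quarticExp, Zsqrtd.norm_eq_one_iff.2 hα]

theorem even_quarticExp_iff (hα : Odd α.norm) (him : Even α.im) :
    Even (quarticExp α) ↔ 4 ∣ α.im := by
  have hE : 4 * (quarticExp α : ℤ) + 1 = α.re ^ 2 + α.im ^ 2 := by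
    rw [four_mul_quarticExp_add_one_int hα, norm_eq_sq_add_sq]
  obtain ⟨k, hk⟩ := (odd_norm_iff_odd_re him).1 hα
  obtain ⟨e, he⟩ := him
  have hkk := Int.even_mul_succ_self k
  have hEk : (quarticExp α : ℤ) = k * (k + 1) + e * e := by rw [hk, he] at hE; linarith
  rw [← Int.even_coe_nat, hEk, Int.even_add, iff_true_left hkk, Int.even_mul, or_self, he,
    Int.even_iff]
  omega

theorem quarticExp_pos (hπ : Prime π) (hodd : Odd π.norm) : 0 < quarticExp π := by
  have hunit : π.norm.natAbs ≠ 1 := fun h => hπ.not_isUnit (Zsqrtd.norm_eq_one_iff.1 h)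
  have := four_mul_quarticExp_add_one hodd
  omega

theorem quarticResidueSymbol_spec (hπ : Prime π) (hodd : Odd π.norm) (α : ℤ[i]) :
    quarticResidueSymbol α π ^ 5 = quarticResidueSymbol α π ∧
      π ∣ α ^ quarticExp π - quarticResidueSymbol α π := by
  have hfermat := dvd_pow_norm_sub hπ hodd α
  have hfactor : α ^ π.norm.natAbs - α = α * ((α ^ quarticExp π - 1) *
      ((α ^ quarticExp π - 𝐢) * ((α ^ quarticExp π + 1) * (α ^ quarticExp π - -𝐢)))) := by
    rw [← four_mul_quarticExp_add_one hodd, pow_succ, mul_comm 4, pow_mul]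
    linear_combination (α * ((α ^ quarticExp π) ^ 2 - 1)) * sqrtd_sq
  rw [hfactor, hπ.dvd_mul, hπ.dvd_mul, hπ.dvd_mul, hπ.dvd_mul] at hfermat
  unfold quarticResidueSymbol
  split_ifs with h0 h1 h2 h3
  · exact ⟨by simp, by simpa using dvd_pow h0 (quarticExp_pos hπ hodd).ne'⟩
  · exact ⟨by decide, h1⟩
  · exact ⟨by decide, h2⟩
  · exact ⟨by decide, by simpa using h3⟩
  · exact ⟨by decide, (((hfermat.resolve_left h0).resolve_left h1).resolve_left h2).resolve_left h3⟩

theorem quarticResidueSymbol_pow_five (hπ : Prime π) (hodd : Odd π.norm) (α : ℤ[i]) :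
    quarticResidueSymbol α π ^ 5 = quarticResidueSymbol α π :=
  (quarticResidueSymbol_spec hπ hodd α).1

theorem quarticResidueSymbol_eq (hπ : Prime π) (hodd : Odd π.norm) {u : ℤ[i]} (hu : u ^ 5 = u)
    (h : π ∣ α ^ quarticExp π - u) : quarticResidueSymbol α π = u :=
  have ⟨hfive, hdvd⟩ := quarticResidueSymbol_spec hπ hodd α
  eq_of_dvd_sub hπ.not_isUnit hodd hfive hu (by simpa using dvd_sub h hdvd)

theorem map_quarticResidueSymbol {K : Type*} [Ring K] (hπ : Prime π) (hodd : Odd π.norm)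
    {φ : ℤ[i] →+* K} (hφ : ∀ α, φ α = 0 ↔ π ∣ α) (α : ℤ[i]) :
    φ (quarticResidueSymbol α π) = φ α ^ quarticExp π := by
  rw [← map_pow, eq_comm, ← sub_eq_zero, ← map_sub, hφ]
  exact (quarticResidueSymbol_spec hπ hodd α).2

theorem quarticResidueSymbol_mul (hπ : Prime π) (hodd : Odd π.norm) (α β : ℤ[i]) :
    quarticResidueSymbol (α * β) π = quarticResidueSymbol α π * quarticResidueSymbol β π := by
  obtain ⟨hα, hα'⟩ := quarticResidueSymbol_spec hπ hodd α
  obtain ⟨hβ, hβ'⟩ := quarticResidueSymbol_spec hπ hodd β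
  exact quarticResidueSymbol_eq hπ hodd (by rw [mul_pow, hα, hβ])
    (mul_pow α β _ ▸ dvd_mul_sub_mul hα' hβ')

theorem quarticResidueSymbol_one (hπ : Prime π) (hodd : Odd π.norm) :
    quarticResidueSymbol 1 π = 1 :=
  quarticResidueSymbol_eq hπ hodd (one_pow 5) (by simp)

theorem quarticResidueSymbol_congr (hπ : Prime π) (hodd : Odd π.norm) (h : π ∣ α - β) :
    quarticResidueSymbol α π = quarticResidueSymbol β π := by
  obtain ⟨hβ, hβ'⟩ := quarticResidueSymbol_spec hπ hodd β
  refine quarticResidueSymbol_eq hπ hodd hβ ?_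
  simpa using dvd_add (h.trans (sub_dvd_pow_sub_pow _ _ (quarticExp π))) hβ'

theorem quarticResidueSymbol_associated (h : Associated π β) (α : ℤ[i]) :
    quarticResidueSymbol α π = quarticResidueSymbol α β := by
  have hdvd (γ : ℤ[i]) : π ∣ γ ↔ β ∣ γ := h.dvd_iff_dvd_left
  have hnorm := Zsqrtd.norm_eq_of_associated (by norm_num) h
  unfold quarticResidueSymbol
  rw [hnorm]
  classical exact if_congr (hdvd _) rfl <| if_congr (hdvd _) rfl <| if_congr (hdvd _) rfl <|
    if_congr (hdvd _) rfl rfl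

theorem quarticResidueSymbol_star (hπ : Prime π) (hodd : Odd π.norm) (α : ℤ[i]) :
    quarticResidueSymbol (star α) (star π) = star (quarticResidueSymbol α π) := by
  obtain ⟨hα, hα'⟩ := quarticResidueSymbol_spec hπ hodd α
  refine quarticResidueSymbol_eq (prime_star hπ) (odd_norm_star hodd) (by rw [← star_pow, hα]) ?_
  rw [quarticExp, Zsqrtd.norm_conj, ← star_pow, ← star_sub]
  exact map_dvd (starRingEnd ℤ[i]) hα'

theorem quarticResidueSymbol_pow_four (hπ : Prime π) (hodd : Odd π.norm) (h : ¬ π ∣ α) :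
    quarticResidueSymbol α π ^ 4 = 1 := by
  obtain ⟨hα, hα'⟩ := quarticResidueSymbol_spec hπ hodd α
  have hne : quarticResidueSymbol α π ≠ 0 :=
    fun h0 => h (hπ.dvd_of_dvd_pow (by simpa [h0] using hα'))
  exact mul_right_cancel₀ hne (by rw [one_mul, ← pow_succ, hα])

end ResidueSymbol

section JacobiSymbol

@[elab_as_elim]
theorem odd_norm_induction {P : ∀ β : ℤ[i], Odd β.norm → Prop}
    (isUnit : ∀ u (_ : IsUnit u) hu, P u hu)
    (prime_mul : ∀ π β (_ : Prime π) (hπ : Odd π.norm) (hβ : Odd β.norm), P β hβ →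
      P (π * β) (odd_norm_mul hπ hβ)) (β : ℤ[i]) (hβ : Odd β.norm) : P β hβ := by
  induction β using induction_on_prime with
  | h₁ => exact absurd rfl (ne_zero_of_odd_norm hβ)
  | h₂ u hu => exact isUnit u hu hβ
  | h₃ β π _ hπ ih =>
    have hodd : Odd π.norm ∧ Odd β.norm := by rwa [Zsqrtd.norm_mul, Int.odd_mul] at hβ
    exact prime_mul π β hπ hodd.1 hodd.2 (ih hodd.2)

variable {α β γ π : ℤ[i]}

theorem prod_quarticResidueSymbol_of_rel {s t : Multiset ℤ[i]} (h : Multiset.Rel Associated s t)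
    (α : ℤ[i]) :
    (s.map (quarticResidueSymbol α)).prod = (t.map (quarticResidueSymbol α)).prod := by
  induction h with
  | zero => rfl
  | cons hassoc _ ih => simp [quarticResidueSymbol_associated hassoc, ih]

theorem quarticJacobiSymbol_associated (h : Associated β γ) (α : ℤ[i]) :
    quarticJacobiSymbol α β = quarticJacobiSymbol α γ :=
  prod_quarticResidueSymbol_of_rel (factors_rel_of_associated h) α

theorem quarticJacobiSymbol_neg_right (α β : ℤ[i]) :
    quarticJacobiSymbol α (-β) = quarticJacobiSymbol α β :=
  quarticJacobiSymbol_associated (Associated.refl β).neg_left α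

theorem quarticJacobiSymbol_mul_right (hβ : Odd β.norm) (hγ : Odd γ.norm) (α : ℤ[i]) :
    quarticJacobiSymbol α (β * γ) = quarticJacobiSymbol α β * quarticJacobiSymbol α γ := by
  rw [quarticJacobiSymbol, prod_quarticResidueSymbol_of_rel
    (factors_mul (ne_zero_of_odd_norm hβ) (ne_zero_of_odd_norm hγ)), Multiset.map_add,
    Multiset.prod_add, ← quarticJacobiSymbol, ← quarticJacobiSymbol]

theorem quarticJacobiSymbol_of_isUnit (hβ : IsUnit β) (α : ℤ[i]) :
    quarticJacobiSymbol α β = 1 := by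
  simp [quarticJacobiSymbol, factors_of_isUnit hβ]

theorem quarticJacobiSymbol_of_prime (hπ : Prime π) (α : ℤ[i]) :
    quarticJacobiSymbol α π = quarticResidueSymbol α π := by
  obtain ⟨β, hβ, hfactors⟩ := factors_eq_singleton_of_irreducible hπ.irreducible
  simp [quarticJacobiSymbol, hfactors, quarticResidueSymbol_associated hβ]

theorem quarticJacobiSymbol_prime_mul (hπ : Prime π) (hodd : Odd π.norm) (hβ : Odd β.norm)
    (α : ℤ[i]) :
    quarticJacobiSymbol α (π * β) = quarticResidueSymbol α π * quarticJacobiSymbol α β := by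
  rw [quarticJacobiSymbol_mul_right hodd hβ, quarticJacobiSymbol_of_prime hπ]

theorem quarticJacobiSymbol_mul_left (hγ : Odd γ.norm) (α β : ℤ[i]) :
    quarticJacobiSymbol (α * β) γ = quarticJacobiSymbol α γ * quarticJacobiSymbol β γ := by
  induction γ, hγ using odd_norm_induction with
  | isUnit u hu _ => simp [quarticJacobiSymbol_of_isUnit hu]
  | prime_mul π γ hπ hodd hγ ih =>
    simp only [quarticJacobiSymbol_prime_mul hπ hodd hγ, quarticResidueSymbol_mul hπ hodd, ih]
    ring

theorem quarticJacobiSymbol_one_left (hγ : Odd γ.norm) : quarticJacobiSymbol 1 γ = 1 := by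
  induction γ, hγ using odd_norm_induction with
  | isUnit u hu _ => exact quarticJacobiSymbol_of_isUnit hu 1
  | prime_mul π γ hπ hodd hγ ih =>
    rw [quarticJacobiSymbol_prime_mul hπ hodd hγ, ih, quarticResidueSymbol_one hπ hodd, one_mul]

theorem quarticJacobiSymbol_congr (hγ : Odd γ.norm) (h : γ ∣ α - β) :
    quarticJacobiSymbol α γ = quarticJacobiSymbol β γ := by
  induction γ, hγ using odd_norm_induction with
  | isUnit u hu _ => simp [quarticJacobiSymbol_of_isUnit hu]
  | prime_mul π γ hπ hodd hγ ih =>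
    rw [quarticJacobiSymbol_prime_mul hπ hodd hγ, quarticJacobiSymbol_prime_mul hπ hodd hγ,
      ih (dvd_of_mul_left_dvd h), quarticResidueSymbol_congr hπ hodd (dvd_of_mul_right_dvd h)]

theorem quarticJacobiSymbol_star (hγ : Odd γ.norm) (α : ℤ[i]) :
    quarticJacobiSymbol (star α) (star γ) = star (quarticJacobiSymbol α γ) := by
  induction γ, hγ using odd_norm_induction with
  | isUnit u hu _ => simp [quarticJacobiSymbol_of_isUnit hu, quarticJacobiSymbol_of_isUnit hu.star]
  | prime_mul π γ hπ hodd hγ ih =>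
    rw [quarticJacobiSymbol_prime_mul hπ hodd hγ, star_mul', star_mul',
      quarticJacobiSymbol_prime_mul (prime_star hπ) (odd_norm_star hodd) (odd_norm_star hγ),
      quarticResidueSymbol_star hπ hodd, ih]

theorem quarticJacobiSymbol_pow_left (hγ : Odd γ.norm) (α : ℤ[i]) (n : ℕ) :
    quarticJacobiSymbol (α ^ n) γ = quarticJacobiSymbol α γ ^ n := by
  induction n with
  | zero => rw [pow_zero, pow_zero, quarticJacobiSymbol_one_left hγ]
  | succ n ih => rw [pow_succ, quarticJacobiSymbol_mul_left hγ, ih, pow_succ]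

theorem quarticJacobiSymbol_pow_four (hγ : Odd γ.norm) (h : IsCoprime α γ) :
    quarticJacobiSymbol α γ ^ 4 = 1 := by
  induction γ, hγ using odd_norm_induction with
  | isUnit u hu _ => simp [quarticJacobiSymbol_of_isUnit hu]
  | prime_mul π γ hπ hodd hγ ih =>
    rw [IsCoprime.mul_right_iff] at h
    have hndvd : ¬ π ∣ α := fun hdvd => hπ.not_isUnit (h.1.symm.isUnit_of_dvd' dvd_rfl hdvd)
    rw [quarticJacobiSymbol_prime_mul hπ hodd hγ, mul_pow, ih h.2,
      quarticResidueSymbol_pow_four hπ hodd hndvd, one_mul]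

theorem quarticJacobiSymbol_sqrtd_left (hγ : Odd γ.norm) :
    quarticJacobiSymbol 𝐢 γ = 𝐢 ^ quarticExp γ := by
  induction γ, hγ using odd_norm_induction with
  | isUnit u hu _ => rw [quarticJacobiSymbol_of_isUnit hu, quarticExp_of_isUnit hu, pow_zero]
  | prime_mul π γ hπ hodd hγ ih =>
    have hfive : (𝐢 ^ quarticExp π) ^ 5 = 𝐢 ^ quarticExp π := by
      rw [← pow_mul, mul_comm, pow_mul]; congr 1
    rw [quarticJacobiSymbol_prime_mul hπ hodd hγ, ih, quarticExp_mul hodd hγ,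
      quarticResidueSymbol_eq hπ hodd hfive (by simp), pow_add _ _ (4 * _), pow_mul _ 4,
      sqrtd_pow_four, one_pow, mul_one, pow_add]

theorem quarticJacobiSymbol_neg_left (hγ : Odd γ.norm) (α : ℤ[i]) :
    quarticJacobiSymbol (-α) γ = (-1) ^ quarticExp γ * quarticJacobiSymbol α γ := by
  rw [neg_eq_neg_one_mul, ← sqrtd_sq, quarticJacobiSymbol_mul_left hγ,
    quarticJacobiSymbol_pow_left hγ, quarticJacobiSymbol_sqrtd_left hγ, ← pow_mul, ← pow_mul,
    mul_comm 2]

end JacobiSymbol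

section RationalIntegers

theorem even_quarticExp_intCast {n : ℤ} (hn : Odd n) : Even (quarticExp (n : ℤ[i])) :=
  (even_quarticExp_iff (odd_norm_intCast.2 hn) (by simp)).2 (by simp)

theorem quarticJacobiSymbol_neg_left_intCast {n : ℤ} (hn : Odd n) (α : ℤ[i]) :
    quarticJacobiSymbol (-α) n = quarticJacobiSymbol α n := by
  rw [quarticJacobiSymbol_neg_left (odd_norm_intCast.2 hn),
    (even_quarticExp_intCast hn).neg_one_pow, one_mul]

@[elab_as_elim]
theorem odd_int_induction {P : ∀ n : ℤ, Odd n → Prop} (one : P 1 odd_one)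
    (neg : ∀ n hn, P n hn → P (-n) (Odd.neg hn))
    (prime_mul : ∀ (p : ℕ) (n : ℤ) (_ : p.Prime) (hp : Odd (p : ℤ)) (hn : Odd n), P n hn →
      P (p * n) (hp.mul hn)) (n : ℤ) (hn : Odd n) : P n hn := by
  have natCast (m : ℕ) (hm : Odd (m : ℤ)) : P m hm := by
    induction m using induction_on_primes with
    | zero => exact absurd hm (by simp)
    | one => exact_mod_cast one
    | prime_mul p m hp ih =>
      have hodd : Odd (p : ℤ) ∧ Odd (m : ℤ) := by rwa [Nat.cast_mul, Int.odd_mul] at hm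
      exact_mod_cast prime_mul p m hp hodd.1 hodd.2 (ih hodd.2)
  obtain ⟨m, rfl | rfl⟩ := Int.eq_nat_or_neg n
  · exact natCast m hn
  · exact neg _ _ (natCast m (by simpa using hn.neg))

theorem quarticJacobiSymbol_intCast_mul_star {π : ℤ[i]} (hπ : Odd π.norm) {n : ℤ}
    (h : IsCoprime (n : ℤ[i]) π) : quarticJacobiSymbol n (π * star π) = 1 := by
  rw [quarticJacobiSymbol_mul_right hπ (odd_norm_star hπ), ← star_intCast n,
    quarticJacobiSymbol_star hπ, star_intCast,
    mul_star_of_pow_four (quarticJacobiSymbol_pow_four hπ h)]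

theorem quarticJacobiSymbol_intCast_natPrime {p : ℕ} (hp : p.Prime) (hodd : Odd (p : ℤ)) {n : ℤ}
    (h : IsCoprime n p) : quarticJacobiSymbol n (p : ℤ[i]) = 1 := by
  have := Fact.mk hp
  have hodd' : Odd (p : ℤ[i]).norm := by exact_mod_cast odd_norm_intCast.2 hodd
  have hmod : p % 4 = 1 ∨ p % 4 = 3 :=
    Nat.odd_mod_four_iff.1 (Nat.odd_iff.1 (by exact_mod_cast hodd))
  rcases hmod with hmod | hmod
  · obtain ⟨π, hπ⟩ := exists_norm_eq hmod
    have hmul : π * star π = p := by rw [← Zsqrtd.norm_eq_mul_conj, hπ, Int.cast_natCast]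
    have hcop : IsCoprime (n : ℤ[i]) π := by
      refine IsCoprime.of_mul_right_left (z := star π) ?_
      simpa [hmul] using isCoprime_intCast h
    rw [← hmul, quarticJacobiSymbol_intCast_mul_star (hπ ▸ hodd) hcop]
  · have hprime := prime_of_nat_prime_of_mod_four_eq_three p hmod
    have hE : quarticExp (p : ℤ[i]) = (p - 1) * ((p + 1) / 4) := by
      obtain ⟨k, rfl⟩ : ∃ k, p = 4 * k + 3 := ⟨p / 4, by omega⟩
      have hnorm := four_mul_quarticExp_add_one hodd'
      rw [Zsqrtd.norm_natCast, Int.natAbs_mul, Int.natAbs_natCast] at hnorm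
      rw [show (4 * k + 3 + 1) / 4 = k + 1 by omega, show 4 * k + 3 - 1 = 4 * k + 2 by omega]
      linarith
    have hfermat : (p : ℤ) ∣ (n ^ (p - 1)) ^ ((p + 1) / 4) - 1 ^ ((p + 1) / 4) :=
      (Int.ModEq.pow_card_sub_one_eq_one hp h).symm.dvd.trans (sub_dvd_pow_sub_pow _ _ _)
    rw [quarticJacobiSymbol_of_prime hprime]
    refine quarticResidueSymbol_eq hprime hodd' (one_pow 5) ?_
    rw [hE, pow_mul]
    simpa using map_dvd (Int.castRingHom ℤ[i]) hfermat

theorem quarticJacobiSymbol_intCast_intCast {m n : ℤ} (hn : Odd n) (h : IsCoprime m n) :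
    quarticJacobiSymbol m n = 1 := by
  induction n, hn using odd_int_induction with
  | one => exact quarticJacobiSymbol_of_isUnit (by simp) _
  | neg n _ ih => rw [Int.cast_neg, quarticJacobiSymbol_neg_right, ih (by simpa using h.neg_right)]
  | prime_mul p n hp hpo hn ih =>
    rw [IsCoprime.mul_right_iff] at h
    rw [Int.cast_mul, quarticJacobiSymbol_mul_right (odd_norm_intCast.2 hpo)
      (odd_norm_intCast.2 hn), ih h.2, Int.cast_natCast,
      quarticJacobiSymbol_intCast_natPrime hp hpo h.1, one_mul]

theorem quarticJacobiSymbol_sqrtd_intCast {n : ℤ} (hn : Odd n) :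
    quarticJacobiSymbol 𝐢 n = (ZMod.χ₈ n : ℤ) := by
  obtain ⟨j, hj⟩ := even_iff_two_dvd.1 (even_quarticExp_intCast hn)
  have hsq : 4 * (2 * (j : ℤ)) + 1 = n * n := by
    simpa [hj] using four_mul_quarticExp_add_one_int (odd_norm_intCast.2 hn)
  have hj_even : Even j ↔ n % 8 = 1 ∨ n % 8 = 7 := by
    obtain ⟨t, s, rfl, hs⟩ : ∃ t s, n = 8 * t + s ∧ (s = 1 ∨ s = 3 ∨ s = 5 ∨ s = 7) := by
      rw [Int.odd_iff] at hn
      exact ⟨n / 8, n % 8, by omega, by omega⟩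
    rw [Nat.even_iff]
    rcases hs with rfl | rfl | rfl | rfl <;> ring_nf at hsq <;> omega
  rw [quarticJacobiSymbol_sqrtd_left (odd_norm_intCast.2 hn), hj, pow_mul, sqrtd_sq,
    ZMod.χ₈_int_eq_if_mod_eight, if_neg (by rw [Int.odd_iff.1 hn]; decide), neg_one_pow_eq_ite]
  simp only [hj_even]
  split_ifs <;> simp

end RationalIntegers

section GaussSums

variable {F R : Type*} [Field F] [Fintype F]

theorem sum_pow_mul_one_sub_pow {m n : ℕ} (h : m + n < Fintype.card F - 1) :
    ∑ a : F, a ^ m * (1 - a) ^ n = 0 := by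
  have expand (a : F) : a ^ m * (1 - a) ^ n =
      ∑ j ∈ Finset.range (n + 1), (-1) ^ j * (n.choose j : F) * a ^ (j + m) := by
    rw [sub_eq_neg_add, add_pow, Finset.mul_sum]
    refine Finset.sum_congr rfl fun j _ => ?_
    rw [neg_pow a, one_pow, pow_add]
    ring
  simp only [expand]
  rw [Finset.sum_comm]
  refine Finset.sum_eq_zero fun j hj => ?_
  have hj' := Finset.mem_range.1 hj
  rw [← Finset.mul_sum, FiniteField.sum_pow_lt_card_sub_one F _ (by omega), mul_zero]

variable [CommRing R] {χ : MulChar F R} {ψ : AddChar F R}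

theorem pow_char_mul_gaussSum_pow_char {r : ℕ} [Fact r.Prime] [CharP R r] (hr : (r : F) ≠ 0) :
    (χ ^ r) r * gaussSum χ ψ ^ r = gaussSum (χ ^ r) ψ := by
  rw [gaussSum_frob, AddChar.pow_mulShift]
  exact gaussSum_mulShift _ ψ (Units.mk0 _ hr)

variable [IsDomain R]

theorem gaussSum_pow_four (hχ : χ ^ 4 = 1) (hχ2 : χ ^ 2 ≠ 1) (hψ : ψ.IsPrimitive) :
    gaussSum χ ψ ^ 4 = jacobiSum χ χ ^ 2 * Fintype.card F := by
  have hquad : (χ ^ 2).IsQuadratic :=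
    MulChar.isQuadratic_iff_sq_eq_one.2 (by rw [← pow_mul]; exact hχ)
  have hneg : (χ ^ 2) (-1) = 1 := by rw [MulChar.pow_apply' χ two_ne_zero, ← map_pow]; simp
  have hsq : gaussSum (χ ^ 2) ψ ^ 2 = Fintype.card F := by
    rw [gaussSum_sq hχ2 hquad hψ, hneg, one_mul]
  have hjacobi : gaussSum (χ ^ 2) ψ * jacobiSum χ χ = gaussSum χ ψ ^ 2 := by
    rw [sq, sq, jacobiSum_mul_nontrivial (by rwa [← sq]) ψ]
  calc gaussSum χ ψ ^ 4 = (gaussSum χ ψ ^ 2) ^ 2 := by rw [← pow_mul]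
    _ = _ := by rw [← hjacobi, mul_pow, hsq, mul_comm]

theorem gaussSum_mul_gaussSum_inv (hχ : χ ≠ 1) (hψ : ψ.IsPrimitive) :
    gaussSum χ ψ * gaussSum χ⁻¹ ψ = χ (-1) * Fintype.card F := by
  have hinv : χ⁻¹ (-1) = χ (-1) := by
    rw [MulChar.inv_apply', inv_neg, inv_one]
  rw [← gaussSum_mul_gaussSum_eq_card hχ hψ, ← mul_gaussSum_inv_eq_gaussSum χ⁻¹, hinv]
  ring

section PrimeField

variable {r : ℕ} [Fact r.Prime] {K : Type*} [Field K] [CharP K r]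

theorem natCast_prime_ne_zero {p : ℕ} (hp : p.Prime) (hrp : r ≠ p) : (p : K) ≠ 0 := by
  rw [Ne, CharP.cast_eq_zero_iff K r, Nat.prime_dvd_prime_iff_eq Fact.out hp]
  exact hrp

variable {p : ℕ} [Fact p.Prime] [IsAlgClosed K]

theorem exists_isPrimitive_addChar (hrp : r ≠ p) :
    ∃ ψ : AddChar (ZMod p) K, ψ.IsPrimitive := by
  have : NeZero (p : K) := ⟨natCast_prime_ne_zero Fact.out hrp⟩
  obtain ⟨ζ, hζ⟩ := HasEnoughRootsOfUnity.exists_primitiveRoot K p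
  exact ⟨_, AddChar.zmodChar_primitive_of_primitive_root p hζ⟩

variable {χ : MulChar (ZMod p) K}

theorem apply_mul_jacobiSum_pow_of_mod_four_eq_one (hr : r % 4 = 1) (hrp : r ≠ p) (hχ : χ ^ 4 = 1)
    (hχ2 : χ ^ 2 ≠ 1) : χ r * (jacobiSum χ χ ^ 2 * p) ^ (r / 4) = 1 := by
  obtain ⟨ψ, hψ⟩ := exists_isPrimitive_addChar (K := K) hrp
  have hχr : χ ^ r = χ := by rw [pow_eq_pow_mod r hχ, hr, pow_one]
  have hχ1 : χ ≠ 1 := fun h => hχ2 (by rw [h, one_pow])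
  have hg : gaussSum χ ψ ≠ 0 := gaussSum_ne_zero_of_nontrivial
    (by rw [ZMod.card]; exact natCast_prime_ne_zero Fact.out hrp) hχ1 hψ
  have hfrob := pow_char_mul_gaussSum_pow_char (χ := χ) (ψ := ψ)
    (natCast_prime_ne_zero (p := r) (K := ZMod p) Fact.out hrp.symm)
  have hpow := gaussSum_pow_four hχ hχ2 hψ
  rw [ZMod.card] at hpow
  refine mul_right_cancel₀ hg ?_
  rw [one_mul, mul_assoc, ← hpow, ← pow_mul, ← pow_succ, show 4 * (r / 4) + 1 = r by omega]
  rwa [hχr] at hfrob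

theorem inv_apply_mul_jacobiSum_pow_of_mod_four_eq_three (hr : r % 4 = 3) (hrp : r ≠ p)
    (hχ : χ ^ 4 = 1) (hχ2 : χ ^ 2 ≠ 1) :
    χ⁻¹ (-r) * (jacobiSum χ χ ^ 2 * p) ^ (r / 4 + 1) = p := by
  obtain ⟨ψ, hψ⟩ := exists_isPrimitive_addChar (K := K) hrp
  have hχr : χ ^ r = χ⁻¹ := by
    rw [pow_eq_pow_mod r hχ, hr]
    exact eq_inv_of_mul_eq_one_right (by rw [← pow_succ', hχ])
  have hχ1 : χ ≠ 1 := fun h => hχ2 (by rw [h, one_pow])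
  have hneg : χ⁻¹ (-1) * χ (-1) = 1 := by
    rw [MulChar.inv_apply', inv_neg, inv_one, ← map_mul, neg_one_mul, neg_neg, map_one]
  have hfrob := pow_char_mul_gaussSum_pow_char (χ := χ) (ψ := ψ)
    (natCast_prime_ne_zero (p := r) (K := ZMod p) Fact.out hrp.symm)
  have hpow := gaussSum_pow_four hχ hχ2 hψ
  have hinv := gaussSum_mul_gaussSum_inv hχ1 hψ
  rw [ZMod.card] at hpow hinv
  rw [hχr] at hfrob
  calc χ⁻¹ (-r) * (jacobiSum χ χ ^ 2 * p) ^ (r / 4 + 1)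
      = χ⁻¹ (-1) * (gaussSum χ ψ * (χ⁻¹ r * gaussSum χ ψ ^ r)) := by
        rw [← hpow, ← pow_mul, show 4 * (r / 4 + 1) = r + 1 by omega, pow_succ,
          neg_eq_neg_one_mul, map_mul]
        ring
    _ = p := by rw [hfrob, hinv, ← mul_assoc, hneg, one_mul]

end PrimeField

end GaussSums

section QuarticCharacter

variable {p : ℕ} [Fact p.Prime] {π : ℤ[i]}

theorem intCast_re_sq_add_im_sq (hn : π.norm = p) :
    (π.re : ZMod p) ^ 2 + (π.im : ZMod p) ^ 2 = 0 := by
  have := congrArg (Int.cast : ℤ → ZMod p) (norm_eq_sq_add_sq π ▸ hn)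
  push_cast at this
  rwa [ZMod.natCast_self] at this

theorem intCast_re_ne_zero (hn : π.norm = p) : (π.re : ZMod p) ≠ 0 := by
  intro hre
  have him : (π.im : ZMod p) = 0 := by simpa [hre] using intCast_re_sq_add_im_sq hn
  rw [ZMod.intCast_zmod_eq_zero_iff_dvd] at hre him
  have hnorm : (p : ℤ) * p ∣ p * 1 := by
    have := map_dvd Zsqrtd.normMonoidHom ((Zsqrtd.intCast_dvd (d := -1) p π).2 ⟨hre, him⟩)
    simpa [Zsqrtd.normMonoidHom, Zsqrtd.norm_natCast, hn] using this
  have hp := Nat.prime_iff_prime_int.1 (Fact.out : p.Prime)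
  exact hp.not_isUnit (isUnit_of_dvd_one (Int.dvd_of_mul_dvd_mul_left hp.ne_zero hnorm))

theorem exists_ringHom_zmod (hn : π.norm = p) :
    ∃ f : ℤ[i] →+* ZMod p, f 𝐢 = π.im / π.re ∧ ∀ α, f α = 0 ↔ π ∣ α := by
  have hprime := prime_of_norm_eq Fact.out hn
  have hsum := intCast_re_sq_add_im_sq hn
  have hre := intCast_re_ne_zero hn
  let f : ℤ[i] →+* ZMod p := Zsqrtd.lift ⟨(π.im : ZMod p) / π.re, by
    field_simp; push_cast; linear_combination hsum⟩
  have hfπ : f π = 0 := by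
    simp only [f, Zsqrtd.lift_apply_apply]
    field_simp
    rw [hsum, mul_zero]
  refine ⟨f, by simp [f], fun α => ⟨fun h => ?_, fun h => ?_⟩⟩
  · by_contra hndvd
    have := ((hprime.irreducible.coprime_iff_not_dvd.2 hndvd).map f)
    rw [h, hfπ] at this
    exact not_isCoprime_zero_zero this
  · exact zero_dvd_iff.1 (hfπ ▸ map_dvd f h)

theorem quarticResidueSymbol_val (hn : π.norm = p) (hodd : Odd π.norm) (m : ℤ) :
    quarticResidueSymbol ((m : ZMod p).val : ℤ) π = quarticResidueSymbol m π := by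
  have hdvd : π ∣ ((p : ℤ) : ℤ[i]) := by
    rw [← hn, Zsqrtd.norm_eq_mul_conj]; exact dvd_mul_right _ _
  refine quarticResidueSymbol_congr (prime_of_norm_eq Fact.out hn) hodd (hdvd.trans ?_)
  rw [← Int.cast_sub, Zsqrtd.intCast_dvd_intCast, ← ZMod.intCast_eq_intCast_iff_dvd_sub]
  simp

/-- The quartic residue symbol modulo a Gaussian prime `π` of prime norm `p`, as a character of
`ℤ/pℤ`, which the inclusion of the integers identifies with `ℤ[i]/(π)`. -/
noncomputable def quarticChar (hn : π.norm = p) (hodd : Odd π.norm) :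
    MulChar (ZMod p) ℤ[i] where
  toFun a := quarticResidueSymbol (a.val : ℤ) π
  map_one' := by
    rw [← quarticResidueSymbol_one (prime_of_norm_eq Fact.out hn) hodd]
    simpa only [Int.cast_one] using quarticResidueSymbol_val hn hodd 1
  map_mul' a b := by
    rw [← quarticResidueSymbol_mul (prime_of_norm_eq Fact.out hn) hodd, ← Int.cast_mul,
      ← quarticResidueSymbol_val hn hodd (a.val * b.val)]
    simp
  map_nonunit' a ha := by
    rw [isUnit_iff_ne_zero, not_not] at ha
    simp [ha, quarticResidueSymbol]

variable (hn : π.norm = p) (hodd : Odd π.norm)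

theorem quarticChar_intCast (m : ℤ) : quarticChar hn hodd m = quarticResidueSymbol m π :=
  quarticResidueSymbol_val hn hodd m

theorem map_quarticChar {f : ℤ[i] →+* ZMod p} (hf : ∀ α, f α = 0 ↔ π ∣ α) (a : ZMod p) :
    f (quarticChar hn hodd a) = a ^ quarticExp π := by
  obtain ⟨m, rfl⟩ := ZMod.intCast_surjective a
  rw [quarticChar_intCast, map_quarticResidueSymbol (prime_of_norm_eq Fact.out hn) hodd hf,
    map_intCast]

theorem quarticChar_pow_four : quarticChar hn hodd ^ 4 = 1 := by
  obtain ⟨f, -, hf⟩ := exists_ringHom_zmod hn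
  refine MulChar.ext fun a => ?_
  obtain ⟨m, hm⟩ := ZMod.intCast_surjective (a : ZMod p)
  have hndvd : ¬ π ∣ (m : ℤ[i]) := by
    rw [← hf, map_intCast, hm]; exact a.ne_zero
  rw [MulChar.pow_apply' _ four_ne_zero, MulChar.one_apply_coe, ← hm, quarticChar_intCast,
    quarticResidueSymbol_pow_four (prime_of_norm_eq Fact.out hn) hodd hndvd]

theorem exists_quarticChar_sq_eq_neg_one : ∃ a, quarticChar hn hodd a ^ 2 = -1 := by
  obtain ⟨f, -, hf⟩ := exists_ringHom_zmod hn
  have hE := four_mul_quarticExp_add_one hodd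
  rw [hn, Int.natAbs_natCast] at hE
  obtain ⟨a, ha⟩ := FiniteField.exists_nonsquare (F := ZMod p)
    (by rw [ZMod.ringChar_zmod_n]; omega)
  have ha0 : a ≠ 0 := by rintro rfl; exact ha (.zero)
  have hpow : (quarticChar hn hodd a ^ 2) ^ 2 = 1 := by
    rw [← pow_mul, ← MulChar.pow_apply' _ four_ne_zero, quarticChar_pow_four,
      MulChar.one_apply (isUnit_iff_ne_zero.2 ha0)]
  refine ⟨a, (sq_eq_one_iff.1 hpow).resolve_left ?_⟩
  intro h1
  refine ha ((ZMod.euler_criterion p ha0).2 ?_)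
  have := congrArg f h1
  rwa [map_pow, map_quarticChar hn hodd hf, map_one, ← pow_mul,
    show quarticExp π * 2 = p / 2 by omega] at this

theorem quarticChar_ringHomComp_sq_ne_one {K : Type*} [Field K] (h2 : (2 : K) ≠ 0)
    (φ : ℤ[i] →+* K) : (quarticChar hn hodd).ringHomComp φ ^ 2 ≠ 1 := by
  obtain ⟨a, ha⟩ := exists_quarticChar_sq_eq_neg_one hn hodd
  have ha0 : a ≠ 0 := by
    rintro rfl
    rw [MulChar.map_zero] at ha
    exact absurd ha (by decide)
  intro h
  have happly := congrArg (fun χ => χ a) h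
  simp only [MulChar.pow_apply' _ two_ne_zero, MulChar.ringHomComp_apply,
    MulChar.one_apply (isUnit_iff_ne_zero.2 ha0)] at happly
  rw [← map_pow, ha, map_neg, map_one] at happly
  exact h2 (by linear_combination -happly)

theorem quarticChar_ringHomComp_star :
    (quarticChar hn hodd).ringHomComp (starRingEnd ℤ[i]) = (quarticChar hn hodd)⁻¹ := by
  refine eq_inv_of_mul_eq_one_right (MulChar.ext fun a => ?_)
  rw [MulChar.mul_apply, MulChar.ringHomComp_apply, MulChar.one_apply_coe]
  refine mul_star_of_pow_four ?_
  rw [← MulChar.pow_apply' _ four_ne_zero, quarticChar_pow_four, MulChar.one_apply_coe]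

theorem norm_jacobiSum_quarticChar :
    (jacobiSum (quarticChar hn hodd) (quarticChar hn hodd)).norm = p := by
  refine Int.cast_injective (α := ℤ[i]) (toComplex_injective ?_)
  have hsq := quarticChar_ringHomComp_sq_ne_one hn hodd (K := ℂ) two_ne_zero toComplex
  have hne : (quarticChar hn hodd).ringHomComp toComplex ≠ 1 := fun h => hsq (by rw [h, one_pow])
  have h := jacobiSum_mul_jacobiSum_inv (F := ZMod p) (F' := ℂ)
    (by rw [ringChar.eq_zero, ZMod.ringChar_zmod_n]; exact (Fact.out : p.Prime).ne_zero.symm)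
    hne hne (by rwa [← sq])
  rw [MulChar.ringHomComp_inv, ← quarticChar_ringHomComp_star, jacobiSum_ringHomComp,
    jacobiSum_ringHomComp, jacobiSum_ringHomComp, ZMod.card, ← map_mul, starRingEnd_apply,
    ← Zsqrtd.norm_eq_mul_conj] at h
  rw [h]
  simp

theorem dvd_jacobiSum_quarticChar :
    π ∣ jacobiSum (quarticChar hn hodd) (quarticChar hn hodd) := by
  obtain ⟨f, -, hf⟩ := exists_ringHom_zmod hn
  have hE := four_mul_quarticExp_add_one hodd
  rw [hn, Int.natAbs_natCast] at hE
  have hpos := quarticExp_pos (prime_of_norm_eq Fact.out hn) hodd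
  rw [← hf, jacobiSum, map_sum]
  simp only [map_mul, map_quarticChar hn hodd hf]
  exact sum_pow_mul_one_sub_pow (by rw [ZMod.card]; omega)

theorem odd_re_jacobiSum_quarticChar :
    Odd (jacobiSum (quarticChar hn hodd) (quarticChar hn hodd)).re := by
  have hprim : IsPrimitiveRoot 𝐢 4 :=
    IsPrimitiveRoot.mk_of_lt _ (by norm_num) (by decide) fun l hl hl4 => by
      interval_cases l <;> decide
  have hcard : 4 ∣ Fintype.card (ZMod p) - 1 := by
    rw [ZMod.card, ← Int.natAbs_natCast p, ← hn, ← four_mul_quarticExp_add_one hodd]; simp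
  obtain ⟨z, -, hz⟩ := exists_jacobiSum_eq_neg_one_add (by norm_num)
    (quarticChar_pow_four hn hodd) (quarticChar_pow_four hn hodd) hcard hprim
  have hre : (-1 + z * (𝐢 - 1) ^ 2).re = 2 * (z.im - 1) + 1 := by
    rw [show (𝐢 - 1) ^ 2 = ⟨0, -2⟩ by decide, Zsqrtd.re_add, Zsqrtd.re_mul, Zsqrtd.re_neg,
      Zsqrtd.re_one]
    ring
  exact ⟨z.im - 1, by rw [hz, hre]⟩

/-- Since `π` divides the Jacobi sum `J` and both have norm `p`, they differ by a unit; as `J.re`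
is odd, that unit is `±1`. -/
theorem jacobiSum_quarticChar_sq (him : Even π.im) :
    jacobiSum (quarticChar hn hodd) (quarticChar hn hodd) ^ 2 = π ^ 2 := by
  obtain ⟨u, hu⟩ := dvd_jacobiSum_quarticChar hn hodd
  have hnorm := norm_jacobiSum_quarticChar hn hodd
  have hJ_re := odd_re_jacobiSum_quarticChar hn hodd
  rw [hu] at hJ_re hnorm ⊢
  have hu_norm : u.norm = 1 := by
    have hp : (p : ℤ) ≠ 0 := by exact_mod_cast (Fact.out : p.Prime).ne_zero
    rw [Zsqrtd.norm_mul, hn] at hnorm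
    exact mul_left_cancel₀ hp (hnorm.trans (mul_one _).symm)
  have hu_re : u.re ≠ 0 := fun h0 => by
    rw [Zsqrtd.re_mul, h0, mul_zero, zero_add] at hJ_re
    exact Int.not_even_iff_odd.2 hJ_re ((him.mul_left _).mul_right _)
  rw [mul_pow, sq_eq_one_of_norm_eq_one hu_norm hu_re, mul_one]

end QuarticCharacter

section PrimeReciprocity

variable {p r : ℕ} [Fact p.Prime] [Fact r.Prime] {π l : ℤ[i]}

theorem jacobiSum_ringHomComp_quarticChar_sq_mul {K : Type*} [Field K] (hn : π.norm = p)
    (hodd : Odd π.norm) (him : Even π.im) (φ : ℤ[i] →+* K) :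
    jacobiSum ((quarticChar hn hodd).ringHomComp φ) ((quarticChar hn hodd).ringHomComp φ) ^ 2 * p =
      φ (π ^ 3 * star π) := by
  have hp : (p : ℤ[i]) = π * star π := by rw [← Zsqrtd.norm_eq_mul_conj, hn, Int.cast_natCast]
  rw [jacobiSum_ringHomComp, ← map_pow, jacobiSum_quarticChar_sq hn hodd him, ← map_natCast φ,
    ← map_mul, hp]
  congr 1
  ring

section

variable {K : Type*} [Field K] [CharP K r]

theorem two_ne_zero_of_charP (hr : Odd r) : (2 : K) ≠ 0 := by
  have : r ≠ 2 := by rintro rfl; exact absurd hr (by decide)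
  exact_mod_cast natCast_prime_ne_zero (K := K) Nat.prime_two this

variable [IsAlgClosed K]

theorem map_quarticResidueSymbol_mul_pow (hn : π.norm = p) (hodd : Odd π.norm) (him : Even π.im)
    (hr : r % 4 = 1) (hrp : r ≠ p) (φ : ℤ[i] →+* K) :
    φ (quarticResidueSymbol r π) * φ (π ^ 3 * star π) ^ (r / 4) = 1 := by
  have h2 : (2 : K) ≠ 0 := two_ne_zero_of_charP (r := r) (Nat.odd_iff.2 (by omega))
  rw [← Int.cast_natCast r, ← quarticChar_intCast hn hodd, Int.cast_natCast,
    ← MulChar.ringHomComp_apply, ← jacobiSum_ringHomComp_quarticChar_sq_mul hn hodd him]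
  exact apply_mul_jacobiSum_pow_of_mod_four_eq_one hr hrp
    (by rw [MulChar.ringHomComp_pow, quarticChar_pow_four, MulChar.ringHomComp_one])
    (quarticChar_ringHomComp_sq_ne_one hn hodd h2 φ)

theorem map_star_quarticResidueSymbol_neg_mul_pow (hn : π.norm = p) (hodd : Odd π.norm)
    (him : Even π.im) (hr : r % 4 = 3) (hrp : r ≠ p) (φ : ℤ[i] →+* K) :
    φ (star (quarticResidueSymbol (-r) π)) * φ (π ^ 3 * star π) ^ (r / 4 + 1) = p := by
  have h2 : (2 : K) ≠ 0 := two_ne_zero_of_charP (r := r) (Nat.odd_iff.2 (by omega))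
  rw [← Int.cast_natCast r, ← Int.cast_neg, ← quarticChar_intCast hn hodd, ← starRingEnd_apply,
    ← MulChar.ringHomComp_apply, quarticChar_ringHomComp_star, ← MulChar.ringHomComp_apply,
    ← MulChar.ringHomComp_inv, ← jacobiSum_ringHomComp_quarticChar_sq_mul hn hodd him,
    Int.cast_neg, Int.cast_natCast]
  exact inv_apply_mul_jacobiSum_pow_of_mod_four_eq_three hr hrp
    (by rw [MulChar.ringHomComp_pow, quarticChar_pow_four, MulChar.ringHomComp_one])
    (quarticChar_ringHomComp_sq_ne_one hn hodd h2 φ)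

end

theorem quarticResidueSymbol_natCast_mul (hn : π.norm = p) (hodd : Odd π.norm)
    (him : Even π.im) (hl : l.norm = r) (hr : r % 4 = 1) (hrp : r ≠ p) :
    quarticResidueSymbol r π * quarticResidueSymbol (π ^ 3 * star π) l = 1 := by
  have hπ := prime_of_norm_eq Fact.out hn
  have hl_prime := prime_of_norm_eq Fact.out hl
  have hl_odd : Odd l.norm := by rw [hl, Int.odd_iff]; omega
  have hdvd : l ∣ (r : ℤ[i]) := by
    rw [← Int.cast_natCast r, ← hl, Zsqrtd.norm_eq_mul_conj]; exact dvd_mul_right _ _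
  have hE : quarticExp l = r / 4 := by rw [quarticExp, hl]; omega
  obtain ⟨K, _, _, _, φ, hφ⟩ := exists_ringHom_isAlgClosed hl_prime (r := r) Fact.out hdvd
  refine eq_of_map_eq hl_prime hl_odd hφ ?_ (one_pow 5) ?_
  · rw [mul_pow, quarticResidueSymbol_pow_five hπ hodd,
      quarticResidueSymbol_pow_five hl_prime hl_odd]
  · rw [map_mul, map_quarticResidueSymbol hl_prime hl_odd hφ, hE,
      map_quarticResidueSymbol_mul_pow hn hodd him hr hrp, map_one]

theorem star_quarticResidueSymbol_neg_natCast_mul (hn : π.norm = p) (hodd : Odd π.norm)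
    (him : Even π.im) (hr : r % 4 = 3) (hrp : r ≠ p) :
    star (quarticResidueSymbol (-r) π) * quarticResidueSymbol π r = 1 := by
  have hπ := prime_of_norm_eq Fact.out hn
  have hr_prime := prime_of_nat_prime_of_mod_four_eq_three r hr
  have hr_odd : Odd (r : ℤ[i]).norm := by
    rw [Zsqrtd.norm_natCast, ← Nat.cast_mul, Int.odd_coe_nat, Nat.odd_mul, Nat.odd_iff]
    omega
  obtain ⟨K, _, _, _, φ, hφ⟩ := exists_ringHom_isAlgClosed hr_prime (r := r) Fact.out dvd_rfl
  have hp : (p : K) = φ π ^ (r + 1) := by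
    rw [pow_succ', map_pow_char_of_mod_four_eq_three hr, ← map_mul, ← Zsqrtd.norm_eq_mul_conj, hn,
      Int.cast_natCast, map_natCast]
  have hbase : φ (π ^ 3 * star π) = φ π ^ (r + 3) := by
    rw [map_mul, map_pow, ← map_pow_char_of_mod_four_eq_three hr, ← pow_add, add_comm]
  have hE : (r + 3) * (r / 4 + 1) = quarticExp (r : ℤ[i]) + (r + 1) := by
    have hnorm := four_mul_quarticExp_add_one hr_odd
    obtain ⟨k, rfl⟩ : ∃ k, r = 4 * k + 3 := ⟨r / 4, by omega⟩
    rw [Zsqrtd.norm_natCast, Int.natAbs_mul, Int.natAbs_natCast] at hnorm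
    rw [show (4 * k + 3) / 4 = k by omega]
    linarith
  have hgauss := map_star_quarticResidueSymbol_neg_mul_pow hn hodd him hr hrp φ
  rw [hbase, ← pow_mul, hE, pow_add, ← mul_assoc, ← hp,
    ← map_quarticResidueSymbol hr_prime hr_odd hφ, ← map_mul] at hgauss
  refine eq_of_map_eq hr_prime hr_odd hφ ?_ (one_pow 5) ?_
  · rw [mul_pow, ← star_pow, quarticResidueSymbol_pow_five hπ hodd,
      quarticResidueSymbol_pow_five hr_prime hr_odd]
  · rw [map_one]
    exact (mul_eq_right₀ (natCast_prime_ne_zero Fact.out hrp)).1 hgauss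

theorem quarticResidueSymbol_pow_four_of_ne_zero {π α : ℤ[i]} (hπ : Prime π) (hodd : Odd π.norm)
    (h : quarticResidueSymbol α π ≠ 0) : quarticResidueSymbol α π ^ 4 = 1 :=
  quarticResidueSymbol_pow_four hπ hodd fun hdvd => h (if_pos hdvd)

theorem quarticJacobiSymbol_natCast_of_mod_four_eq_one (hn : π.norm = p) (hodd : Odd π.norm)
    (him : Even π.im) (hr : r % 4 = 1) (hrp : r ≠ p) :
    quarticJacobiSymbol r π = quarticJacobiSymbol π r := by
  obtain ⟨l, hl⟩ := exists_norm_eq hr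
  have hl_odd : Odd l.norm := by rw [hl, Int.odd_iff]; omega
  have hl_prime := prime_of_norm_eq Fact.out hl
  have hl_star := prime_star hl_prime
  have hl_star_odd := odd_norm_star hl_odd
  have hl_mul : l * star l = r := by rw [← Zsqrtd.norm_eq_mul_conj, hl, Int.cast_natCast]
  have hright : quarticJacobiSymbol π r =
      quarticResidueSymbol π l * quarticResidueSymbol π (star l) := by
    rw [← hl_mul, quarticJacobiSymbol_mul_right hl_odd hl_star_odd,
      quarticJacobiSymbol_of_prime hl_prime, quarticJacobiSymbol_of_prime hl_star]
  rw [hright, quarticJacobiSymbol_of_prime (prime_of_norm_eq Fact.out hn)]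
  have hstar : quarticResidueSymbol (star π) l = star (quarticResidueSymbol π (star l)) := by
    rw [← quarticResidueSymbol_star hl_star hl_star_odd, star_star]
  have hgauss : quarticResidueSymbol r π *
      (quarticResidueSymbol π l ^ 3 * star (quarticResidueSymbol π (star l))) = 1 := by
    have := quarticResidueSymbol_natCast_mul hn hodd him hl hr hrp
    rwa [← hstar, pow_succ, sq, ← quarticResidueSymbol_mul hl_prime hl_odd,
      ← quarticResidueSymbol_mul hl_prime hl_odd, ← quarticResidueSymbol_mul hl_prime hl_odd,
      ← sq, ← pow_succ]
  have hpow := quarticResidueSymbol_pow_four_of_ne_zero hl_prime hl_odd (α := π)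
    fun h => by simp [h] at hgauss
  have hpow' := quarticResidueSymbol_pow_four_of_ne_zero hl_star hl_star_odd (α := π)
    fun h => by simp [h] at hgauss
  linear_combination quarticResidueSymbol π l * quarticResidueSymbol π (star l) * hgauss
    - quarticResidueSymbol r π * quarticResidueSymbol π (star l) *
      star (quarticResidueSymbol π (star l)) * hpow
    - quarticResidueSymbol r π * mul_star_of_pow_four hpow'

theorem quarticJacobiSymbol_neg_natCast_of_mod_four_eq_three (hn : π.norm = p) (hodd : Odd π.norm)
    (him : Even π.im) (hr : r % 4 = 3) (hrp : r ≠ p) :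
    quarticJacobiSymbol (-r) π = quarticJacobiSymbol π r := by
  have hπ := prime_of_norm_eq Fact.out hn
  have hgauss := star_quarticResidueSymbol_neg_natCast_mul hn hodd him hr hrp
  have hpow := quarticResidueSymbol_pow_four_of_ne_zero hπ hodd (α := -r)
    fun h => by simp [h] at hgauss
  rw [quarticJacobiSymbol_of_prime hπ,
    quarticJacobiSymbol_of_prime (prime_of_nat_prime_of_mod_four_eq_three r hr)]
  linear_combination quarticResidueSymbol π r * mul_star_of_pow_four hpow -
    quarticResidueSymbol (-r) π * hgauss

end PrimeReciprocity

section ReciprocityLaw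

theorem emod_four_of_odd {n : ℤ} (hn : Odd n) : n % 4 = 1 ∨ n % 4 = 3 := by
  rw [Int.odd_iff] at hn; omega

theorem eq_one_or_neg_one_of_isUnit {u : ℤ[i]} (hu : IsUnit u) (hre : u.re ≠ 0) :
    u = 1 ∨ u = -1 :=
  sq_eq_one_iff.1 (sq_eq_one_of_norm_eq_one ((Zsqrtd.norm_eq_one_iff' (by norm_num) u).2 hu) hre)

theorem exists_associated_even_im {α : ℤ[i]} (hα : Odd α.norm) :
    ∃ β, Associated α β ∧ Even β.im := by
  rcases Int.even_or_odd α.im with him | him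
  · exact ⟨α, .refl α, him⟩
  · have hre : Even α.re := by
      rw [norm_eq_sq_add_sq, Int.odd_add', Int.odd_pow' two_ne_zero,
        Int.even_pow' two_ne_zero] at hα
      exact hα.1 him
    exact ⟨α * 𝐢, (associated_mul_isUnit_right_iff (.of_pow_eq_one sqrtd_pow_four four_ne_zero)).2
      (.refl α), by simpa using hre⟩

@[elab_as_elim]
theorem even_im_induction {P : ∀ α : ℤ[i], Odd α.norm → Even α.im → Prop}
    (one : P 1 (by simp) (by simp))
    (neg : ∀ α hα him, P α hα him → P (-α) (by rwa [Zsqrtd.norm_neg]) (Even.neg him))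
    (prime_mul : ∀ π α (_ : Prime π) (hπ : Odd π.norm) (_ : Even π.im) (hα : Odd α.norm) him hmul,
      P α hα him → P (π * α) (odd_norm_mul hπ hα) hmul)
    (α : ℤ[i]) (hα : Odd α.norm) (him : Even α.im) : P α hα him := by
  suffices h : ∀ β, Associated α β → ∀ hβ hβ', P β hβ hβ' from h α (.refl α) hα him
  clear him
  induction α, hα using odd_norm_induction with
  | isUnit u hu _ =>
    intro β hβ hβ_odd hβ_im
    have hre : β.re ≠ 0 := fun h0 => by
      simpa [h0] using (odd_norm_iff_odd_re hβ_im).1 hβ_odd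
    rcases eq_one_or_neg_one_of_isUnit (hβ.isUnit hu) hre with rfl | rfl
    · exact one
    · exact neg 1 _ _ one
  | prime_mul π α hπ hodd _ ih =>
    intro β hβ hβ_odd hβ_im
    obtain ⟨π', hassoc, hπ'_im⟩ := exists_associated_even_im hodd
    obtain ⟨γ, rfl⟩ := ((hassoc.mul_right α).symm.trans hβ).dvd_iff_dvd_right.1 (dvd_mul_right π' α)
    have hγ : Associated α γ :=
      ((hassoc.mul_right α).symm.trans hβ).of_mul_left (.refl π') (hassoc.ne_zero_iff.1 hπ.ne_zero)
    rw [Zsqrtd.norm_mul, Int.odd_mul] at hβ_odd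
    have hπ'_re := (odd_norm_iff_odd_re hπ'_im).1 hβ_odd.1
    have hγ_im : Even γ.im := by
      rw [Zsqrtd.im_mul, Int.even_add, iff_true_right (hπ'_im.mul_right _), Int.even_mul] at hβ_im
      exact hβ_im.resolve_left (Int.not_even_iff_odd.2 hπ'_re)
    exact prime_mul π' γ (hassoc.prime hπ) hβ_odd.1 hπ'_im hβ_odd.2 hγ_im hβ_im
      (ih γ hγ hβ_odd.2 hγ_im)

theorem quarticJacobiSymbol_eq_zero {π α β : ℤ[i]} (hπ : Prime π) (hβ : Odd β.norm) (hα : π ∣ α)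
    (hπβ : π ∣ β) : quarticJacobiSymbol α β = 0 := by
  obtain ⟨γ, rfl⟩ := hπβ
  rw [Zsqrtd.norm_mul, Int.odd_mul] at hβ
  rw [quarticJacobiSymbol_prime_mul hπ hβ.1 hβ.2, quarticResidueSymbol, if_pos hα, zero_mul]

theorem eq_intCast_or_neg_of_associated {π : ℤ[i]} {n : ℤ} (hodd : Odd π.norm) (him : Even π.im)
    (h : Associated π n) : π = n ∨ π = -n := by
  obtain ⟨u, rfl⟩ := h.symm
  have hre : Odd (n * u.val.re) := by
    simpa [Zsqrtd.re_mul] using (odd_norm_iff_odd_re him).1 hodd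
  have hu_re : u.val.re ≠ 0 := fun h0 => by simp [h0] at hre
  rcases eq_one_or_neg_one_of_isUnit u.isUnit hu_re with hu | hu <;> simp [hu]

theorem χ₄_pow_of_even {R : Type*} [Ring R] {n : ℤ} (hn : Odd n) {k : ℕ} (hk : Even k) :
    ((ZMod.χ₄ n : ℤ) : R) ^ k = 1 := by
  rcases emod_four_of_odd hn with h | h
  · rw [ZMod.χ₄_int_one_mod_four h, Int.cast_one, one_pow]
  · rw [ZMod.χ₄_int_three_mod_four h, Int.cast_neg, Int.cast_one, hk.neg_one_pow]

theorem quarticJacobiSymbol_natPrime_of_norm_eq {π : ℤ[i]} {p : ℕ} [Fact p.Prime]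
    (hn : π.norm = p) (hodd : Odd π.norm) (him : Even π.im) {r : ℕ} [Fact r.Prime]
    (hr_odd : Odd (r : ℤ)) (hrp : r ≠ p) :
    quarticJacobiSymbol (r : ℤ) π =
      (ZMod.χ₄ (r : ℤ) : ℤ) ^ quarticExp π * quarticJacobiSymbol π (r : ℤ) := by
  rw [Int.cast_natCast]
  rcases emod_four_of_odd hr_odd with hr4 | hr4
  · rw [ZMod.χ₄_int_one_mod_four hr4, Int.cast_one, one_pow, one_mul]
    exact quarticJacobiSymbol_natCast_of_mod_four_eq_one hn hodd him (by omega) hrp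
  · rw [ZMod.χ₄_int_three_mod_four hr4, Int.cast_neg, Int.cast_one,
      ← quarticJacobiSymbol_neg_natCast_of_mod_four_eq_three hn hodd him (by omega) hrp,
      ← quarticJacobiSymbol_neg_left hodd, neg_neg]

theorem quarticJacobiSymbol_natPrime_of_associated {π : ℤ[i]} {p : ℕ} (hp : p.Prime)
    (hπ : Associated π p) (hodd : Odd π.norm) (him : Even π.im) {r : ℕ} (hr : r.Prime)
    (hr_odd : Odd (r : ℤ)) (hrp : r ≠ p) :
    quarticJacobiSymbol (r : ℤ) π =
      (ZMod.χ₄ (r : ℤ) : ℤ) ^ quarticExp π * quarticJacobiSymbol π (r : ℤ) := by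
  have hcop : IsCoprime (r : ℤ) p := Nat.isCoprime_iff_coprime.2 ((Nat.coprime_primes hr hp).2 hrp)
  rw [← Int.cast_natCast] at hπ
  have hp_odd : Odd (p : ℤ) := by
    rwa [← odd_norm_intCast, ← Zsqrtd.norm_eq_of_associated (by norm_num) hπ]
  rw [quarticJacobiSymbol_associated hπ, quarticJacobiSymbol_intCast_intCast hp_odd hcop]
  rcases eq_intCast_or_neg_of_associated hodd him hπ with rfl | rfl
  · rw [χ₄_pow_of_even hr_odd (even_quarticExp_intCast hp_odd),
      quarticJacobiSymbol_intCast_intCast hr_odd hcop.symm, one_mul]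
  · rw [quarticExp, Zsqrtd.norm_neg, χ₄_pow_of_even hr_odd (even_quarticExp_intCast hp_odd),
      quarticJacobiSymbol_neg_left_intCast hr_odd,
      quarticJacobiSymbol_intCast_intCast hr_odd hcop.symm, one_mul]

theorem quarticJacobiSymbol_natPrime_prime {π : ℤ[i]} (hπ : Prime π) (hodd : Odd π.norm)
    (him : Even π.im) {r : ℕ} (hr : r.Prime) (hr_odd : Odd (r : ℤ)) :
    quarticJacobiSymbol (r : ℤ) π =
      (ZMod.χ₄ (r : ℤ) : ℤ) ^ quarticExp π * quarticJacobiSymbol π (r : ℤ) := by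
  obtain ⟨p, hp, hdvd, hcases⟩ := split_or_inert hπ hodd
  have := Fact.mk hp
  have := Fact.mk hr
  by_cases hrp : r = p
  · have hdvd' : π ∣ ((r : ℤ) : ℤ[i]) := by rw [hrp, Int.cast_natCast]; exact hdvd
    rw [quarticJacobiSymbol_eq_zero hπ hodd hdvd' dvd_rfl,
      quarticJacobiSymbol_eq_zero hπ (odd_norm_intCast.2 hr_odd) dvd_rfl hdvd', mul_zero]
  rcases hcases with ⟨-, hn⟩ | ⟨-, hassoc⟩
  · exact quarticJacobiSymbol_natPrime_of_norm_eq hn hodd him hr_odd hrp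
  · exact quarticJacobiSymbol_natPrime_of_associated hp hassoc hodd him hr hr_odd hrp

theorem quarticJacobiSymbol_natPrime {α : ℤ[i]} (hα : Odd α.norm)
    (him : Even α.im) {r : ℕ} (hr : r.Prime) (hr_odd : Odd (r : ℤ)) :
    quarticJacobiSymbol (r : ℤ) α =
      (ZMod.χ₄ (r : ℤ) : ℤ) ^ quarticExp α * quarticJacobiSymbol α (r : ℤ) := by
  have hr' := odd_norm_intCast.2 hr_odd
  induction α, hα, him using even_im_induction with
  | one =>
    rw [quarticJacobiSymbol_of_isUnit isUnit_one, quarticJacobiSymbol_one_left hr',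
      quarticExp_of_isUnit isUnit_one, pow_zero, one_mul]
  | neg α _ _ ih =>
    rw [quarticJacobiSymbol_neg_right, quarticJacobiSymbol_neg_left_intCast hr_odd, quarticExp,
      Zsqrtd.norm_neg, ih]
  | prime_mul π α hπ hπ_odd hπ_im hα _ _ ih =>
    rw [quarticJacobiSymbol_mul_right hπ_odd hα, quarticJacobiSymbol_mul_left hr', ih,
      quarticJacobiSymbol_natPrime_prime hπ hπ_odd hπ_im hr hr_odd, quarticExp_mul hπ_odd hα,
      pow_add _ _ (4 * _), pow_mul _ 4,
      χ₄_pow_of_even hr_odd (k := 4) (by decide), one_pow, mul_one, pow_add]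
    ring

theorem quarticJacobiSymbol_intCast {α : ℤ[i]} (hα : Odd α.norm) (him : Even α.im) {n : ℤ}
    (hn : Odd n) :
    quarticJacobiSymbol n α =
      (ZMod.χ₄ n : ℤ) ^ quarticExp α * quarticJacobiSymbol α n := by
  induction n, hn using odd_int_induction with
  | one =>
    rw [quarticJacobiSymbol_of_isUnit (β := ((1 : ℤ) : ℤ[i])) (by simp), Int.cast_one,
      quarticJacobiSymbol_one_left hα]
    simp
  | neg n _ ih =>
    have hχ : ZMod.χ₄ ((-n : ℤ) : ZMod 4) = -ZMod.χ₄ n := by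
      rw [Int.cast_neg, ← neg_one_mul, map_mul, show ZMod.χ₄ (-1) = -1 by decide, neg_one_mul]
    rw [Int.cast_neg n, quarticJacobiSymbol_neg_left hα, quarticJacobiSymbol_neg_right, ih, hχ,
      Int.cast_neg, neg_pow (Int.cast _), mul_assoc]
  | prime_mul r n hr hr_odd hn ih =>
    rw [Int.cast_mul, quarticJacobiSymbol_mul_left hα, quarticJacobiSymbol_mul_right
      (odd_norm_intCast.2 hr_odd) (odd_norm_intCast.2 hn), ih,
      quarticJacobiSymbol_natPrime hα him hr hr_odd, Int.cast_mul r n, map_mul, Int.cast_mul,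
      mul_pow]
    ring

theorem quarticJacobiSymbol_comm_of_four_dvd_im {α : ℤ[i]} (hα : Odd α.norm) (him : 4 ∣ α.im)
    {n : ℤ} (hn : Odd n) : quarticJacobiSymbol n α = quarticJacobiSymbol α n := by
  have him' : Even α.im := even_iff_two_dvd.2 (dvd_trans (by decide) him)
  rw [quarticJacobiSymbol_intCast hα him' hn,
    χ₄_pow_of_even hn ((even_quarticExp_iff hα him').2 him), one_mul]

end ReciprocityLaw

section SupplementaryLaws

variable {β : ℤ[i]}

theorem χ₈_sq_of_odd {n : ℤ} (hn : Odd n) : ZMod.χ₈ n ^ 2 = 1 := by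
  rw [ZMod.χ₈_int_eq_if_mod_eight, if_neg (by rw [Int.odd_iff.1 hn]; decide)]
  split_ifs <;> rfl

theorem quarticJacobiSymbol_sqrtd_of_four_dvd_im (hβ : Odd β.norm) (him : 4 ∣ β.im) :
    quarticJacobiSymbol 𝐢 β = (ZMod.χ₈ β.re : ℤ) := by
  have hre := (odd_norm_iff_odd_re (even_iff_two_dvd.2 (dvd_trans (by decide) him))).1 hβ
  have hβ_exp := four_mul_quarticExp_add_one_int hβ
  have hre_exp := four_mul_quarticExp_add_one_int (odd_norm_intCast.2 hre)
  obtain ⟨e, he⟩ := him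
  rw [norm_eq_sq_add_sq, he] at hβ_exp
  rw [Zsqrtd.norm_intCast] at hre_exp
  have hexp : quarticExp β = quarticExp (β.re : ℤ[i]) + 4 * e.natAbs ^ 2 := by
    rw [← Int.natCast_inj, Nat.cast_add, Nat.cast_mul, Nat.cast_pow, Int.natCast_natAbs, sq_abs,
      Nat.cast_ofNat]
    linarith
  rw [quarticJacobiSymbol_sqrtd_left hβ, hexp, pow_add, pow_mul _ 4, sqrtd_pow_four, one_pow,
    mul_one, ← quarticJacobiSymbol_sqrtd_left (odd_norm_intCast.2 hre),
    quarticJacobiSymbol_sqrtd_intCast hre]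

theorem quarticJacobiSymbol_re_left (hβ : Odd β.norm) (him : 4 ∣ β.im)
    (hcop : IsCoprime β.re β.im) :
    quarticJacobiSymbol β.re β = (ZMod.χ₈ β.re : ℤ) := by
  have hre := (odd_norm_iff_odd_re (even_iff_two_dvd.2 (dvd_trans (by decide) him))).1 hβ
  have hcongr : (β.re : ℤ[i]) ∣ β - 𝐢 * β.im := ⟨1, by ext <;> simp⟩
  rw [quarticJacobiSymbol_comm_of_four_dvd_im hβ him hre,
    quarticJacobiSymbol_congr (odd_norm_intCast.2 hre) hcongr,
    quarticJacobiSymbol_mul_left (odd_norm_intCast.2 hre),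
    quarticJacobiSymbol_intCast_intCast hre hcop.symm, mul_one,
    quarticJacobiSymbol_sqrtd_intCast hre]

theorem quarticJacobiSymbol_re_add_im_left_sq (hβ : Odd β.norm) (him : 4 ∣ β.im)
    (hcop : IsCoprime β.re β.im) :
    quarticJacobiSymbol (β.re + β.im : ℤ) β ^ 2 = (ZMod.χ₈ (β.re + β.im : ℤ) : ℤ) := by
  have him' : Even β.im := even_iff_two_dvd.2 (dvd_trans (by decide) him)
  have hsum : Odd (β.re + β.im) := ((odd_norm_iff_odd_re him').1 hβ).add_even him'
  have hsum' := odd_norm_intCast.2 hsum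
  have hcongr : ((β.re + β.im : ℤ) : ℤ[i]) ∣ β ^ 2 - 𝐢 * (-2 * β.re ^ 2 : ℤ) :=
    ⟨β.re - β.im + 2 * 𝐢 * β.re, by ext <;> simp [sq] <;> ring⟩
  have hcop_re : IsCoprime β.re (β.re + β.im) := by
    simpa [add_comm] using hcop.add_mul_left_right 1
  have hcop' : IsCoprime (-2 * β.re ^ 2) (β.re + β.im) :=
    (Int.isCoprime_two_left.2 hsum).neg_left.mul_left hcop_re.pow_left
  rw [quarticJacobiSymbol_comm_of_four_dvd_im hβ him hsum, ← quarticJacobiSymbol_pow_left hsum',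
    quarticJacobiSymbol_congr hsum' hcongr, quarticJacobiSymbol_mul_left hsum',
    quarticJacobiSymbol_intCast_intCast hsum hcop', mul_one,
    quarticJacobiSymbol_sqrtd_intCast hsum]

theorem quarticJacobiSymbol_two_left (hβ : Odd β.norm) (him : 4 ∣ β.im)
    (hcop : IsCoprime β.re β.im) :
    quarticJacobiSymbol 2 β = (ZMod.χ₈ β.re * ZMod.χ₈ (β.re + β.im : ℤ) : ℤ) := by
  have hre := (odd_norm_iff_odd_re (even_iff_two_dvd.2 (dvd_trans (by decide) him))).1 hβ
  -- `β.im ≡ 𝐢 * β.re` modulo `β`, and `(1 + 𝐢) ^ 2 = 2 * 𝐢`.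
  have hcongr : β ∣ 2 * 𝐢 * (β.re : ℤ[i]) ^ 2 - ((β.re + β.im : ℤ) : ℤ[i]) ^ 2 :=
    ⟨𝐢 * ((1 + 𝐢) * β.re + (β.re + β.im)), by ext <;> simp [sq] <;> ring⟩
  have hmul := quarticJacobiSymbol_congr hβ hcongr
  rw [quarticJacobiSymbol_mul_left hβ, quarticJacobiSymbol_mul_left hβ,
    quarticJacobiSymbol_pow_left hβ, quarticJacobiSymbol_pow_left hβ,
    quarticJacobiSymbol_re_left hβ him hcop, quarticJacobiSymbol_re_add_im_left_sq hβ him hcop,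
    quarticJacobiSymbol_sqrtd_of_four_dvd_im hβ him, ← Int.cast_pow, χ₈_sq_of_odd hre,
    Int.cast_one, mul_one] at hmul
  have hsq : ((ZMod.χ₈ β.re : ℤ) : ℤ[i]) ^ 2 = 1 := by
    rw [← Int.cast_pow, χ₈_sq_of_odd hre, Int.cast_one]
  rw [Int.cast_mul]
  linear_combination (ZMod.χ₈ β.re : ℤ) * hmul - quarticJacobiSymbol 2 β * hsq

end SupplementaryLaws

section NormRepresentation

variable {π : ℤ[i]} {q x y : ℤ}

theorem odd_norm_intCast_add_two_mul (hx : Odd x) (π : ℤ[i]) : Odd (x + 2 * π : ℤ[i]).norm := by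
  rw [odd_norm_iff_odd_re (by simp)]
  simpa using hx.add_even (even_two_mul π.re)

theorem quarticJacobiSymbol_self_add_two_mul (hx : Odd x) (π : ℤ[i]) :
    quarticJacobiSymbol (x + 2 * π) x = quarticJacobiSymbol π x := by
  have hx' := odd_norm_intCast.2 hx
  have hcongr : (x : ℤ[i]) ∣ (x + 2 * π) - (2 : ℤ) * π := ⟨1, by simp⟩
  rw [quarticJacobiSymbol_congr hx' hcongr, quarticJacobiSymbol_mul_left hx',
    quarticJacobiSymbol_intCast_intCast hx (Int.isCoprime_two_left.2 hx), one_mul]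

theorem isCoprime_of_four_mul_norm_eq (hx : Odd x) (h : 4 * π.norm = x ^ 2 + q * y ^ 2)
    (hcop : IsCoprime (x + 2 * π.re) π.im) : IsCoprime (x + 2 * π.re) (q * y ^ 2) := by
  have hodd : Odd (x + 2 * π.re) := hx.add_even (even_two_mul _)
  have hcop' : IsCoprime (x + 2 * π.re) (2 ^ 2 * π.im ^ 2) :=
    (Int.isCoprime_two_right.2 hodd).pow_right.mul_right hcop.pow_right
  have hmul : 2 ^ 2 * π.im ^ 2 = q * y ^ 2 + (x + 2 * π.re) * (x - 2 * π.re) := by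
    rw [norm_eq_sq_add_sq] at h
    linear_combination h
  rw [hmul] at hcop'
  exact hcop'.of_add_mul_left_right

theorem quarticJacobiSymbol_eq_sq_of_four_mul_norm_eq (hx : Odd x) (hy : Odd y)
    (h : 4 * π.norm = x ^ 2 + q * y ^ 2) (hcop : IsCoprime (x + 2 * π.re) π.im) :
    quarticJacobiSymbol π y = quarticJacobiSymbol (x + 2 * π) y ^ 2 := by
  have hy' := odd_norm_intCast.2 hy
  have hcop_re : IsCoprime (x + 2 * π.re) y :=
    (IsCoprime.pow_right_iff two_pos).1 (isCoprime_of_four_mul_norm_eq hx h hcop).of_mul_right_right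
  have hcop_y : IsCoprime (2 ^ 2 * (x + 2 * π.re)) y :=
    (Int.isCoprime_two_left.2 hy).pow_left.mul_left hcop_re
  have hcongr : (y : ℤ[i]) ∣ (x + 2 * π) ^ 2 - (2 ^ 2 * (x + 2 * π.re) : ℤ) * π := by
    refine ⟨-(q * y), ?_⟩
    have htrace : π + star π = (2 * π.re : ℤ) := by ext <;> simp [two_mul]
    have hnorm := congrArg (Int.cast : ℤ → ℤ[i]) h
    rw [Int.cast_mul, Zsqrtd.norm_eq_mul_conj] at hnorm
    push_cast at htrace hnorm ⊢
    linear_combination 4 * π * htrace - hnorm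
  rw [← quarticJacobiSymbol_pow_left hy', quarticJacobiSymbol_congr hy' hcongr,
    quarticJacobiSymbol_mul_left hy', quarticJacobiSymbol_intCast_intCast hy hcop_y, one_mul]

theorem intCast_add_two_mul_dvd (h : 4 * π.norm = x ^ 2 + q * y ^ 2) :
    (x : ℤ[i]) + 2 * π ∣ q * (y : ℤ[i]) ^ 2 - -(2 * x * (x + 2 * π.re : ℤ)) := by
  refine ⟨star (x + 2 * π), ?_⟩
  rw [norm_eq_sq_add_sq] at h
  rw [← Zsqrtd.norm_eq_mul_conj, norm_eq_sq_add_sq]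
  simp only [Zsqrtd.re_add, Zsqrtd.im_add, Zsqrtd.re_intCast, Zsqrtd.im_intCast, Zsqrtd.re_mul,
    Zsqrtd.im_mul, Zsqrtd.re_ofNat, Zsqrtd.im_ofNat]
  norm_cast
  linear_combination -h

theorem quarticJacobiSymbol_add_two_mul (him : Even π.im) (hq : Odd q) (hx : Odd x) (hy : Odd y)
    (h : 4 * π.norm = x ^ 2 + q * y ^ 2) (hcop : IsCoprime (x + 2 * π.re) π.im) :
    quarticJacobiSymbol (x + 2 * π) q * quarticJacobiSymbol π y =
      (ZMod.χ₈ (x + 2 * π.re + 2 * π.im : ℤ) : ℤ) * quarticJacobiSymbol π x := by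
  have hβ := odd_norm_intCast_add_two_mul hx π
  have hcongr := quarticJacobiSymbol_congr hβ (intCast_add_two_mul_dvd h)
  have hsq := quarticJacobiSymbol_eq_sq_of_four_mul_norm_eq hx hy h hcop
  have hself := quarticJacobiSymbol_self_add_two_mul hx π
  set β : ℤ[i] := x + 2 * π with hβ_def
  have hβ_re : β.re = x + 2 * π.re := by simp [hβ_def]
  have hβ_im : β.im = 2 * π.im := by simp [hβ_def]
  have hdvd_im : 4 ∣ β.im := hβ_im ▸ mul_dvd_mul_left 2 him.two_dvd
  have hre_odd : Odd (x + 2 * π.re) := hx.add_even (even_two_mul _)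
  have hcop_β : IsCoprime β.re β.im := by
    rw [hβ_re, hβ_im]; exact (Int.isCoprime_two_right.2 hre_odd).mul_right hcop
  have hneg : Even (quarticExp β) := (even_quarticExp_iff hβ (hβ_im ▸ even_two_mul _)).2 hdvd_im
  rw [← hβ_re, quarticJacobiSymbol_neg_left hβ, hneg.neg_one_pow, one_mul,
    quarticJacobiSymbol_mul_left hβ, quarticJacobiSymbol_mul_left hβ,
    quarticJacobiSymbol_mul_left hβ, quarticJacobiSymbol_pow_left hβ,
    quarticJacobiSymbol_comm_of_four_dvd_im hβ hdvd_im hq,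
    quarticJacobiSymbol_comm_of_four_dvd_im hβ hdvd_im hy,
    quarticJacobiSymbol_comm_of_four_dvd_im hβ hdvd_im hx, hself, ← hsq,
    quarticJacobiSymbol_two_left hβ hdvd_im hcop_β,
    quarticJacobiSymbol_re_left hβ hdvd_im hcop_β] at hcongr
  rw [hcongr, mul_right_comm, ← Int.cast_mul, mul_right_comm, ← sq, hβ_re, hβ_im,
    χ₈_sq_of_odd hre_odd, one_mul]

end NormRepresentation

section RationalSymbol

theorem map_val_zpow {K : Type*} [Field K] (f : ℤ[i] →+* K) (u : ℤ[i]ˣ) (k : ℤ) :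
    f ↑(u ^ k) = f u ^ k := by
  rw [← MonoidHom.coe_coe, ← Units.coe_map, map_zpow, Units.val_zpow_eq_zpow_val, Units.coe_map]

theorem map_eq_zpow_of_toComplex_eq {K : Type*} [Field K] (f : ℤ[i] →+* K) {α : ℤ[i]} {k : ℤ}
    (h : toComplex α = Complex.I ^ k) : f α = f 𝐢 ^ k := by
  let u : ℤ[i]ˣ := .ofPowEqOne 𝐢 4 sqrtd_pow_four four_ne_zero
  have hα : α = ↑(u ^ k) := toComplex_injective (by
    rw [h, map_val_zpow, Units.val_ofPowEqOne, toComplex_def]; simp)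
  rw [hα, map_val_zpow, Units.val_ofPowEqOne]

theorem dvd_mul_ratResidue_sub {m n q : ℤ} (hn : n ≠ 0) (hnq : IsCoprime n q) :
    q ∣ n * ratResidue ((m : ℚ) / n) q - m := by
  set r : ℚ := (m : ℚ) / n with hr
  obtain ⟨e, he⟩ : (r.den : ℤ) ∣ n := by
    rw [hr, ← Rat.divInt_eq_div]; exact Rat.den_dvd m n
  have hden : IsCoprime (r.den : ℤ) q := hnq.of_isCoprime_of_dvd_left ⟨e, he⟩
  have hnum : e * r.num = m := by
    have hm : (m : ℚ) = n * r := by rw [hr]; field_simp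
    rw [he] at hm
    have : (e * r.num : ℚ) = m := by
      rw [hm, ← Rat.mul_den_eq_num r]; push_cast; ring
    exact_mod_cast this
  have hspec := (ratResidue_spec r q (Int.isCoprime_iff_gcd_eq_one.1 hden)).symm.dvd
  rw [he, ← hnum, mul_comm (r.den : ℤ), mul_assoc, ← mul_sub]
  exact hspec.mul_left e

theorem quarticJacobiSymbolRat_div {m n q : ℤ} (hq : Odd q) (hn : n ≠ 0) (hnq : IsCoprime n q) :
    quarticJacobiSymbolRat ((m : ℚ) / n) q = quarticJacobiSymbol ⟨m, n⟩ q := by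
  have hq' := odd_norm_intCast.2 hq
  have hcongr : (q : ℤ[i]) ∣ n * ⟨ratResidue ((m : ℚ) / n) q, 1⟩ - ⟨m, n⟩ := by
    rw [Zsqrtd.intCast_dvd]
    simpa using dvd_mul_ratResidue_sub hn hnq
  rw [← quarticJacobiSymbol_congr hq' hcongr, quarticJacobiSymbol_mul_left hq',
    quarticJacobiSymbol_intCast_intCast hq hnq, one_mul]
  rfl

theorem quarticJacobiSymbolRat_neg_two_mul_div {π : ℤ[i]} {q x y : ℤ} (hq : Odd q) (hx : Odd x)
    (h : 4 * π.norm = x ^ 2 + q * y ^ 2) (hcop : IsCoprime (x + 2 * π.re) π.im) :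
    quarticJacobiSymbolRat (-2 * (π.im : ℚ) / ((x : ℚ) + 2 * (π.re : ℚ))) q =
      quarticJacobiSymbol (𝐢 * (x + 2 * π)) q := by
  have hden_odd : Odd (x + 2 * π.re) := hx.add_even (even_two_mul _)
  have hden : x + 2 * π.re ≠ 0 := by
    intro h0
    rw [h0] at hden_odd
    exact Int.not_odd_zero hden_odd
  have hfrac := quarticJacobiSymbolRat_div (m := -2 * π.im) hq hden
    (isCoprime_of_four_mul_norm_eq hx h hcop).of_mul_right_left
  push_cast at hfrac
  rw [hfrac]
  congr 1
  ext <;> simp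

end RationalSymbol

section CharactersModEight

variable {K : Type*} [Field K] {x c d : ℤ}

theorem χ₈_add_of_four_dvd (hx : Odd x) (hc : c % 4 = 1) (hd : 4 ∣ d) :
    ((ZMod.χ₈ (x + 2 * c + 2 * d : ℤ) : ℤ) : K) = -(-1) ^ (x / 4) := by
  have hx8 : x % 8 = 1 ∨ x % 8 = 3 ∨ x % 8 = 5 ∨ x % 8 = 7 := by rw [Int.odd_iff] at hx; omega
  rw [ZMod.χ₈_int_eq_if_mod_eight, if_neg (by omega)]
  rcases hx8 with h | h | h | h
  · rw [if_neg (by omega), Even.neg_one_zpow (Int.even_iff.2 (by omega))]; simp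
  · rw [if_neg (by omega), Even.neg_one_zpow (Int.even_iff.2 (by omega))]; simp
  · rw [if_pos (by omega), Odd.neg_one_zpow (Int.odd_iff.2 (by omega))]; simp
  · rw [if_pos (by omega), Odd.neg_one_zpow (Int.odd_iff.2 (by omega))]; simp

theorem χ₈_mul_χ₄_of_not_four_dvd (hx : Odd x) (hc : c % 4 = 1) (hd : Even d) (hd4 : ¬ 4 ∣ d) :
    ZMod.χ₈ (x + 2 * c + 2 * d : ℤ) * ZMod.χ₄ x = ZMod.χ₈ x := by
  rw [Int.odd_iff] at hx
  rw [Int.even_iff] at hd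
  simp only [ZMod.χ₈_int_eq_if_mod_eight, ZMod.χ₄_int_eq_if_mod_four]
  split_ifs <;> omega

theorem χ₈_eq_neg_one_zpow (hx : Odd x) :
    ((ZMod.χ₈ x : ℤ) : K) = (-1) ^ ((x ^ 2 - 1) / 8) := by
  obtain ⟨t, s, rfl, hs⟩ : ∃ t s, x = 8 * t + s ∧ (s = 1 ∨ s = 3 ∨ s = 5 ∨ s = 7) :=
    ⟨x / 8, x % 8, by omega, by rw [Int.odd_iff] at hx; omega⟩
  have hdiv : ((8 * t + s) ^ 2 - 1) / 8 = 2 * (4 * t ^ 2 + t * s) + (s ^ 2 - 1) / 8 := by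
    rw [show (8 * t + s) ^ 2 - 1 = s ^ 2 - 1 + 8 * (2 * (4 * t ^ 2 + t * s)) by ring,
      Int.add_mul_ediv_left _ _ (by norm_num), add_comm]
  rw [hdiv, ZMod.χ₈_int_mod_eight, Int.mul_add_emod_self_left]
  rcases hs with rfl | rfl | rfl | rfl
  · rw [Even.neg_one_zpow (Int.even_iff.2 (by omega))]; simp
  · rw [Odd.neg_one_zpow (Int.odd_iff.2 (by omega))]; simp
  · rw [Odd.neg_one_zpow (Int.odd_iff.2 (by omega))]; simp
  · rw [Even.neg_one_zpow (Int.even_iff.2 (by omega))]; simp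

theorem χ₈_mul_χ₄_pow_of_even {π : ℤ[i]} (hx : Odd x) (hodd : Odd π.norm) (him : Even π.im)
    (hre : π.re % 4 = 1) (hE : Even (quarticExp π)) :
    ((ZMod.χ₈ (x + 2 * π.re + 2 * π.im : ℤ) : ℤ) : K) * (ZMod.χ₄ x : ℤ) ^ quarticExp π =
      -(-1) ^ (x / 4) := by
  rw [χ₈_add_of_four_dvd hx hre ((even_quarticExp_iff hodd him).1 hE), χ₄_pow_of_even hx hE,
    mul_one]

theorem χ₈_mul_χ₄_pow_of_odd {π : ℤ[i]} (hx : Odd x) (hodd : Odd π.norm) (him : Even π.im)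
    (hre : π.re % 4 = 1) (hE : Odd (quarticExp π)) :
    ((ZMod.χ₈ (x + 2 * π.re + 2 * π.im : ℤ) : ℤ) : K) * (ZMod.χ₄ x : ℤ) ^ quarticExp π =
      (-1) ^ ((x ^ 2 - 1) / 8) := by
  have him4 : ¬ 4 ∣ π.im := (even_quarticExp_iff hodd him).not.1 (Nat.not_even_iff_odd.2 hE)
  rw [← χ₈_eq_neg_one_zpow hx, ← χ₈_mul_χ₄_of_not_four_dvd hx hre him him4, Int.cast_mul]
  obtain ⟨m, hm⟩ := hE
  rw [hm, pow_succ, χ₄_pow_of_even hx (even_two_mul m), one_mul]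

end CharactersModEight

section Reduction

variable {p : ℕ} [Fact p.Prime] {π : ℤ[i]} {q x y k : ℤ}

theorem map_quarticJacobiSymbol_intCast (hn : π.norm = p) (hodd : Odd π.norm)
    {f : ℤ[i] →+* ZMod p} (hf : ∀ α, f α = 0 ↔ π ∣ α) (n : ℤ) :
    f (quarticJacobiSymbol n π) = (n : ZMod p) ^ quarticExp π := by
  have hπ := prime_of_norm_eq Fact.out hn
  rw [quarticJacobiSymbol_of_prime hπ, map_quarticResidueSymbol hπ hodd hf, map_intCast]

theorem quarticJacobiSymbol_sqrtd_mul_add_two_mul (him : Even π.im) (hodd : Odd π.norm)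
    (hq : q % 8 = 3) (hx : Odd x) (hy : y % 4 = 1) (h : 4 * π.norm = x ^ 2 + q * y ^ 2)
    (hcop : IsCoprime (x + 2 * π.re) π.im) :
    quarticJacobiSymbol (𝐢 * (x + 2 * π)) q * quarticJacobiSymbol y π =
      -((ZMod.χ₈ (x + 2 * π.re + 2 * π.im : ℤ) : ℤ) * (ZMod.χ₄ x : ℤ) ^ quarticExp π *
        quarticJacobiSymbol x π) := by
  have hq_odd : Odd q := Int.odd_iff.2 (by omega)
  have hy_odd : Odd y := Int.odd_iff.2 (by omega)
  have hχ₄ : ((ZMod.χ₄ x : ℤ) : ℤ[i]) ^ quarticExp π * (ZMod.χ₄ x : ℤ) ^ quarticExp π = 1 := by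
    rw [← pow_add, χ₄_pow_of_even hx (Even.add_self _)]
  have hχ₈ : ZMod.χ₈ q = -1 := by rw [ZMod.χ₈_int_mod_eight, hq]; rfl
  rw [quarticJacobiSymbol_mul_left (odd_norm_intCast.2 hq_odd),
    quarticJacobiSymbol_sqrtd_intCast hq_odd, hχ₈, quarticJacobiSymbol_intCast hodd him hy_odd,
    ZMod.χ₄_int_one_mod_four hy, Int.cast_one, one_pow, one_mul,
    quarticJacobiSymbol_intCast hodd him hx, mul_assoc (Int.cast _) (_ ^ _),
    ← mul_assoc (_ ^ _), hχ₄, one_mul,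
    ← quarticJacobiSymbol_add_two_mul him hq_odd hx hy_odd h hcop]
  push_cast
  ring

theorem odd_of_four_mul_eq {n : ℤ} (hq : Odd q) (hy : Odd y)
    (h : 4 * n = x ^ 2 + q * y ^ 2) : Odd x := by
  have heven : Even (x ^ 2 + q * y ^ 2) := h ▸ (by decide : Even (4 : ℤ)).mul_right n
  exact (Int.odd_pow' two_ne_zero).1 ((Int.even_add'.1 heven).2 (hq.mul hy.pow))

theorem neg_eq_div_sq (hy : (y : ZMod p) ≠ 0) (h : 4 * (p : ℤ) = x ^ 2 + q * y ^ 2) :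
    -(q : ZMod p) = (x / y) ^ 2 := by
  have := congrArg (Int.cast : ℤ → ZMod p) h
  push_cast at this
  rw [ZMod.natCast_self, mul_zero] at this
  field_simp
  linear_combination this

theorem intCast_ne_zero_of_four_mul_eq (hp : p ≠ 2) (h : 4 * (p : ℤ) = x ^ 2 + q * y ^ 2) :
    (y : ZMod p) ≠ 0 := by
  have hprime := Nat.prime_iff_prime_int.1 (Fact.out : p.Prime)
  rw [Ne, ZMod.intCast_zmod_eq_zero_iff_dvd]
  intro hy
  have hx : (p : ℤ) ∣ x := by
    refine hprime.dvd_of_dvd_pow (n := 2) ?_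
    rw [← Int.dvd_add_left ((dvd_pow hy two_ne_zero).mul_left q), ← h]
    exact dvd_mul_left _ _
  have hsq : (p : ℤ) * p ∣ p * 2 ^ 2 := by
    rw [mul_comm (p : ℤ) (2 ^ 2), show (2 : ℤ) ^ 2 = 4 by rfl, h, ← sq]
    exact dvd_add (pow_dvd_pow_of_dvd hx 2) ((pow_dvd_pow_of_dvd hy 2).mul_left q)
  have htwo : (p : ℤ) ∣ 2 :=
    hprime.dvd_of_dvd_pow (Int.dvd_of_mul_dvd_mul_left hprime.ne_zero hsq)
  exact hp ((Nat.prime_dvd_prime_iff_eq Fact.out Nat.prime_two).1 (by exact_mod_cast htwo))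

theorem div_pow_quarticExp (hn : π.norm = p) (him : Even π.im) (hodd : Odd π.norm)
    (hq : q % 8 = 3) (hx : Odd x) (hy : y % 4 = 1) (h : 4 * (p : ℤ) = x ^ 2 + q * y ^ 2)
    (hcop : IsCoprime (x + 2 * π.re) π.im)
    (hk : toComplex (quarticJacobiSymbolRat (-2 * (π.im : ℚ) / ((x : ℚ) + 2 * (π.re : ℚ))) q) =
      Complex.I ^ k) :
    ((x : ZMod p) / y) ^ quarticExp π =
      -((ZMod.χ₈ (x + 2 * π.re + 2 * π.im : ℤ) : ℤ) * (ZMod.χ₄ x : ℤ) ^ quarticExp π) *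
        ((π.im : ZMod p) / π.re) ^ k := by
  obtain ⟨f, hfi, hf⟩ := exists_ringHom_zmod hn
  have hp : p ≠ 2 := by rintro rfl; rw [hn] at hodd; exact absurd hodd (by decide)
  rw [← hn] at h
  rw [quarticJacobiSymbolRat_neg_two_mul_div (Int.odd_iff.2 (by omega)) hx h hcop] at hk
  have hmap := congrArg f
    (quarticJacobiSymbol_sqrtd_mul_add_two_mul him hodd hq hx hy h hcop)
  simp only [map_mul f, map_neg, map_pow, map_intCast,
    map_quarticJacobiSymbol_intCast hn hodd hf] at hmap
  rw [map_eq_zpow_of_toComplex_eq f hk, hfi] at hmap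
  have hχ₄ : ((ZMod.χ₄ x : ℤ) : ZMod p) ^ quarticExp π * (ZMod.χ₄ x : ℤ) ^ quarticExp π = 1 := by
    rw [← pow_add, χ₄_pow_of_even hx (Even.add_self _)]
  have hχ₈ : ((ZMod.χ₈ (x + 2 * π.re + 2 * π.im : ℤ) : ℤ) : ZMod p) ^ 2 = 1 := by
    rw [← Int.cast_pow, χ₈_sq_of_odd ((hx.add_even (even_two_mul _)).add_even (even_two_mul _)),
      Int.cast_one]
  rw [hn] at h
  rw [div_pow, div_eq_iff (pow_ne_zero _ (intCast_ne_zero_of_four_mul_eq hp h)), mul_assoc, hmap]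
  linear_combination -(x : ZMod p) ^ quarticExp π *
    (((ZMod.χ₈ (x + 2 * π.re + 2 * π.im : ℤ) : ℤ) : ZMod p) ^ 2 * hχ₄ + hχ₈)

end Reduction

end QuarticReciprocity

open QuarticReciprocity in
theorem theorem3p2 (p : ℕ) [Fact p.Prime] (hp : p % 4 = 1)
    (q c d x y k : ℤ) (hq : q ≡ 3 [ZMOD 8]) (hpq : ¬ (p : ℤ) ∣ q)
    (hcd : (p : ℤ) = c ^ 2 + d ^ 2) (hxy : 4 * (p : ℤ) = x ^ 2 + q * y ^ 2)
    (hc : c ≡ 1 [ZMOD 4]) (hy : y ≡ 1 [ZMOD 4])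
    (hgcd : Int.gcd d (x + 2 * c) = 1)
    (hk : GaussianInt.toComplex
      (quarticJacobiSymbolRat (-2 * (d : ℚ) / ((x : ℚ) + 2 * (c : ℚ))) q) = Complex.I ^ k) :
    (8 ∣ p - 1 →
      (-(q : ZMod p)) ^ (p / 8) = (-1) ^ (x / 4) * ((d : ZMod p) / (c : ZMod p)) ^ k) ∧
    (8 ∣ p - 5 →
      (-(q : ZMod p)) ^ (p / 8) =
        -(-1) ^ ((x ^ 2 - 1) / 8) * ((d : ZMod p) / (c : ZMod p)) ^ k *
          ((y : ZMod p) / (x : ZMod p))) := by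
  let π : GaussianInt := ⟨c, d⟩
  have hn : π.norm = p := by rw [norm_eq_sq_add_sq, hcd]
  have hodd : Odd π.norm := by rw [hn, Int.odd_iff]; omega
  have him : Even d := even_im_of_odd_norm hodd (Int.odd_iff.2 (hc.of_dvd (by decide)))
  have hx : Odd x := odd_of_four_mul_eq (Int.odd_iff.2 (hq.of_dvd (by decide)))
    (Int.odd_iff.2 (hy.of_dvd (by decide))) hxy
  have hy0 : (y : ZMod p) ≠ 0 := intCast_ne_zero_of_four_mul_eq (by omega) hxy
  have hsq : -(q : ZMod p) = (x / y) ^ 2 := neg_eq_div_sq hy0 hxy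
  have hdiv : (x / y : ZMod p) ≠ 0 := fun h0 =>
    hpq ((ZMod.intCast_zmod_eq_zero_iff_dvd q p).1 (by simpa [h0] using hsq))
  have hpow := div_pow_quarticExp hn him hodd hq hx hy hxy
    (Int.isCoprime_iff_gcd_eq_one.2 (Int.gcd_comm _ _ ▸ hgcd)) hk
  have hE : 4 * quarticExp π + 1 = p := by
    rw [four_mul_quarticExp_add_one hodd, hn, Int.natAbs_natCast]
  have hp1 : 1 < p := (Fact.out : p.Prime).one_lt
  rw [hsq, ← pow_mul]
  refine ⟨fun h8 => ?_, fun h8 => ?_⟩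
  · have hE8 : quarticExp π = 2 * (p / 8) := by omega
    rw [← hE8, hpow, χ₈_mul_χ₄_pow_of_even hx hodd him hc (hE8 ▸ even_two_mul _), neg_neg]
  · have hE8 : quarticExp π = 2 * (p / 8) + 1 := by omega
    rw [← inv_div (x : ZMod p), eq_mul_inv_iff_mul_eq₀ hdiv, ← pow_succ, ← hE8, hpow,
      χ₈_mul_χ₄_pow_of_odd hx hodd him hc ⟨_, hE8⟩]
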